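/- **Setting.** Planes $P\in G_{2,3}$ are identified with their orthogonal projection matrices, $G_2(\mathbb R^3)=\mathbb R^3\times G_{2,3}$, repeated indices are summed, $B_\rho(p)$ is the open ball, and $\mathcal H^k$ is the $k$-dimensional Hausdorff measure. If $M\subset\mathbb R^3$ is countably $2$-rectifiable ($\mathcal H^2$-measurable), $\theta$ is $\mathcal H^2$-measurable on $M$ with values in $\{1,2,\dots\}$ at $\mathcal H^2$-a.e. point of $M$, and $T_xM$ is the approximate tangent plane of $M$ at $x$, then $V=\mathbf v(M,\theta)$ means that $V$ is the Radon measure on $G_2(\mathbb R^3)$ given by $\int\varphi\,dV=\int_M\varphi(x,T_xM)\,\theta(x)\,d\mathcal H^2(x)$; its weight measure is $\mu_V=\theta\,\mathcal H^2\llcorner M$. Such a $V$ is an integer rectifiable $2$-varifold. It is a curvature varifold with boundary if there are functions $A_{ijk}\in L^1_{loc}(V)$ and an $\mathbb R^3$-valued Radon measure $\partial V$ on $G_2(\mathbb R^3)$ such that for $i=1,2,3$ and all compactly supported $C^1$ test functions $\varphi(x,P)$ $$\int \big(P_{ij}\,\partial_{x_j}\varphi+A_{ijk}\,\partial_{P_{jk}}\varphi\big)\,dV=-\int\varphi\,A_{jij}\,dV+\int\varphi\,d(\partial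 V)_i .$$ Its mean curvature vector is $\vec H$ with components $H_i(x)=\tfrac12A_{jij}(x,T_xM)$, its Willmore energy is $\mathcal W(V)=\int|\vec H|^2\,d\mu_V$, and its generalized boundary is the $\mathbb R^3$-valued Radon measure $\sigma_V$, singular with respect to $\mu_V$, with $\int \mathrm{div}_{TM}X\,d\mu_V=-2\int\langle\vec H,X\rangle\,d\mu_V+\int X\,d\sigma_V$ for all $X\in C^1_c(\mathbb R^3;\mathbb R^3)$; $|\sigma_V|$ is its total variation measure. **Proposition.** Let $V$ be a $2$-dimensional integer rectifiable curvature varifold with boundary in $\mathbb R^3$ with generalized boundary $\sigma_V$, and let $S\subset\mathbb R^3$ be a compact embedded $1$-dimensional manifold (possibly with boundary) with $\mathcal H^1(S)<+\infty$ and $\operatorname{supp}\sigma_V\subset S$. Assume that $$\mathcal W(V)<+\infty,\qquad \limsup_{R\to\infty}\frac{\mu_V(B_R(0))}{R^2}\le K<+\infty .$$ Then: 1. for every $p\in\mathbb R^3\setminus S$ the limit $\lim_{\rho\searrow0}\mu_V(B_\rho(p))/\rho^2$ exists and is finite; put $\theta_V(p)=\lim_{\rho\searrow0}\frac{\mu_V(B_\rho(p))}{\pi\rho^2}$;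 2. $\theta_V$ is upper semicontinuous on $\mathbb R^3\setminus S$; 3. $\theta_V(p)\le C\big(d(p,S),|\sigma_V|(S),K,\mathcal W(V)\big)$ for every $p\in\mathbb R^3\setminus S$, where the finite constant $C$ depends only on the four quantities shown; 4. the set $M=\{p\in\mathbb R^3\setminus S:\theta_V(p)\ge\tfrac12\}\cup S$ is closed and $V=\mathbf v(M,\theta_V)$ (the values of $\theta_V$ on the $\mathcal H^2$-null set $S$ are irrelevant). -/

import Mathlib

open MeasureTheory Filter Topology Set
open scoped ENNReal NNReal

namespace CurvVarifold

/-- Euclidean three-space. -/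
abbrev E3 : Type := EuclideanSpace ℝ (Fin 3)

/-- Real `3 × 3` matrices, given by their entries `P i j`. -/
abbrev Mat3 : Type := Fin 3 → Fin 3 → ℝ

/-- The Grassmannian of two-dimensional linear subspaces of `E3`; a plane is identified with the
matrix of the orthogonal projection onto it, i.e. with a symmetric idempotent matrix of trace 2. -/
def G23 : Set Mat3 :=
  {P | (∀ i j, P i j = P j i) ∧ (∀ i j, ∑ k, P i k * P k j = P i j) ∧ ∑ i, P i i = 2}

/-- The space `G₂(ℝ³) = ℝ³ × G_{2,3}` on which varifolds live. -/
abbrev GBundle : Type := E3 × G23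

/-- The plane with projection matrix `P`, as a subset of `E3`. -/
def planeSet (P : G23) : Set E3 := {y | ∀ i, ∑ j, P.1 i j * y j = y i}

/-- A Radon measure with values in `E3`, in polar form `dir • tv`: `tv` is its total variation
measure, which is Radon, and `dir` is a measurable field with `|dir| = 1` `tv`-almost everywhere. -/
structure RadonVectorMeasure (X : Type*) [TopologicalSpace X] [MeasurableSpace X] where
  tv : Measure X
  locallyFinite : IsLocallyFiniteMeasure tv
  dir : X → E3
  measurable_dir : Measurable dir
  norm_dir : ∀ᵐ x ∂tv, ‖dir x‖ = 1

/-- A general varifold is a measure on `G₂(ℝ³)`; this is its weight measure `μ_V = π_♯ V`. -/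
noncomputable def weight (V : Measure GBundle) : Measure E3 := V.map Prod.fst

/-- `M` is an `ℋ²`-measurable countably `2`-rectifiable subset of `ℝ³`: up to an `ℋ²`-null set it is
covered by countably many Lipschitz images of `ℝ²`. -/
def CountablyRectifiable (M : Set E3) : Prop :=
  NullMeasurableSet M (μHE[2] : Measure E3) ∧
  ∃ F : ℕ → EuclideanSpace ℝ (Fin 2) → E3,
    (∀ n, ∃ L : ℝ≥0, LipschitzWith L (F n)) ∧
    (μHE[2] : Measure E3) (M \ ⋃ n, range (F n)) = 0

/-- `P` is the approximate tangent plane `T_x M` of `M` at `x` (with respect to the positive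
multiplicity `θ`; for `ℋ²`-almost every `x ∈ M` it does not depend on `θ`): the rescalings of
`θ ℋ²⌞M` about `x` converge weakly to `θ(x) ℋ²⌞P`. -/
def IsApproxTangentPlane (M : Set E3) (θ : E3 → ℝ) (x : E3) (P : G23) : Prop :=
  ∀ f : E3 → ℝ, Continuous f → HasCompactSupport f →
    Tendsto
      (fun r : ℝ => (r ^ 2)⁻¹ * ∫ y in M, f (r⁻¹ • (y - x)) * θ y ∂(μHE[2] : Measure E3))
      (𝓝[>] 0)
      (𝓝 (θ x * ∫ y in planeSet P, f y ∂(μHE[2] : Measure E3)))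

/-- `V = v(M, θ)` is the integer rectifiable varifold carried by the countably `2`-rectifiable set
`M` with the `ℋ²`-measurable multiplicity `θ`, which takes values in `{1, 2, …}` at `ℋ²`-almost
every point of `M`:
`∫ φ(x, P) dV(x, P) = ∫_M φ(x, T_x M) θ(x) dℋ²(x)`, and `V` is a Radon measure. -/
def IsIntegerRectifiable (V : Measure GBundle) (M : Set E3) (θ : E3 → ℝ) : Prop :=
  IsLocallyFiniteMeasure V ∧
  CountablyRectifiable M ∧
  AEMeasurable θ ((μHE[2] : Measure E3).restrict M) ∧
  (∀ᵐ x ∂((μHE[2] : Measure E3).restrict M), ∃ m : ℕ, 1 ≤ m ∧ θ x = m) ∧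
  ∃ T : E3 → G23,
    AEMeasurable T ((μHE[2] : Measure E3).restrict M) ∧
    (∀ᵐ x ∂((μHE[2] : Measure E3).restrict M), IsApproxTangentPlane M θ x (T x)) ∧
    V = (((μHE[2] : Measure E3).restrict M).withDensity
          (fun x => ENNReal.ofReal (θ x))).map (fun x => (x, T x))

/-- The derivative `∂_{x_j} φ` at `z`. -/
noncomputable def dx (φ : E3 × Mat3 → ℝ) (j : Fin 3) (z : E3 × Mat3) : ℝ :=
  fderiv ℝ φ z (EuclideanSpace.single j 1, 0)

/-- The derivative `∂_{P_{jk}} φ` at `z`. -/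
noncomputable def dP (φ : E3 × Mat3 → ℝ) (j k : Fin 3) (z : E3 × Mat3) : ℝ :=
  fderiv ℝ φ z (0, Pi.single j (Pi.single k 1))

/-- The inclusion of `G₂(ℝ³)` into `ℝ³ × ℝ^{3×3}`. -/
def incl (z : GBundle) : E3 × Mat3 := (z.1, z.2.1)

/-- Test functions: `C¹` functions `φ(x, P)` on `ℝ³ × ℝ^{3×3}` which vanish for `x` outside a compact
set (as `G_{2,3}` is compact, their restrictions to `G₂(ℝ³)` are compactly supported). -/
def IsTest (φ : E3 × Mat3 → ℝ) : Prop :=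
  ContDiff ℝ 1 φ ∧ ∃ C : Set E3, IsCompact C ∧ ∀ x ∉ C, ∀ P, φ (x, P) = 0

/-- `V` is a curvature varifold with boundary, with curvature functions `A_{ijk} ∈ L¹_loc(V)` and
boundary measure `∂V = bd`, a Radon vector measure on `G₂(ℝ³)`: for every test function `φ` and `i`,
`∫ (P_{ij} ∂_{x_j} φ + A_{ijk} ∂_{P_{jk}} φ) dV = - ∫ φ A_{jij} dV + ∫ φ d(∂V)_i`. -/
def IsCurvatureVarifold (V : Measure GBundle) (A : Fin 3 → Fin 3 → Fin 3 → GBundle → ℝ)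
    (bd : RadonVectorMeasure GBundle) : Prop :=
  (∀ i j k, LocallyIntegrable (A i j k) V) ∧
  ∀ φ : E3 × Mat3 → ℝ, IsTest φ → ∀ i,
    ∫ z, ((∑ j, z.2.1 i j * dx φ j (incl z)) + ∑ j, ∑ k, A i j k z * dP φ j k (incl z)) ∂V
      = - ∫ z, φ (incl z) * ∑ j, A j i j z ∂V + ∫ z, φ (incl z) * bd.dir z i ∂bd.tv

/-- The mean curvature vector `H_i = ½ A_{jij}` of a curvature varifold, a function on `G₂(ℝ³)`
(the varifold only sees its values at the points `(x, T_x M)`). -/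
noncomputable def meanCurvature (A : Fin 3 → Fin 3 → Fin 3 → GBundle → ℝ) (z : GBundle) : E3 :=
  WithLp.toLp 2 (fun i => (∑ j, A j i j z) / 2)

/-- The Willmore energy `W(V) = ∫ |H|² dμ_V`. -/
noncomputable def willmore (V : Measure GBundle) (H : GBundle → E3) : ℝ≥0∞ :=
  ∫⁻ z, ‖H z‖ₑ ^ 2 ∂V

/-- `H` is the generalized mean curvature and `σ` the generalized boundary of `V`: `H` is locally
integrable, `σ` is a Radon vector measure singular with respect to `μ_V`, and
`∫ div_{TM} X dμ_V = - 2 ∫ ⟨H, X⟩ dμ_V + ∫ X dσ` for all `X ∈ C¹_c(ℝ³; ℝ³)`, where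
`div_{TM} X = tr (P ∇X)` for `P = T_x M`. -/
def IsGeneralizedBoundary (V : Measure GBundle) (H : GBundle → E3)
    (σ : RadonVectorMeasure E3) : Prop :=
  LocallyIntegrable H V ∧ σ.tv ⟂ₘ weight V ∧
  ∀ X : E3 → E3, ContDiff ℝ 1 X → HasCompactSupport X →
    ∫ z, (∑ i, ∑ j, z.2.1 i j * fderiv ℝ X z.1 (EuclideanSpace.single j 1) i) ∂V
      = - 2 * ∫ z, inner ℝ (H z) (X z.1) ∂V + ∫ x, inner ℝ (X x) (σ.dir x) ∂σ.tv

/-- A compact embedded (topological) `1`-dimensional manifold in `ℝ³`, possibly with boundary: a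
compact set which, with the subspace topology, is locally homeomorphic to a half-line. -/
def IsCompactOneManifold (S : Set E3) : Prop :=
  IsCompact S ∧ Nonempty (ChartedSpace (EuclideanHalfSpace 1) S)

end CurvVarifold

namespace CurvVarifold

/-! The engine is Simon's monotonicity formula. Test the first variation with X(x) = (max(|x - p|,
s)⁻² - r⁻²)₊ (x - p) and complete a square on the annulus s ≤ |x - p| < r. With A(ρ) = ρ⁻² μ(B_ρ(p))
+ ρ⁻² ∫_{B_ρ(p)} ⟨H, x - p⟩ + ¼ ∫_{B_ρ(p)} |H|² (`monoQuantity`), this gives A(s) ≤ A(r) plus a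
boundary term, which vanishes if the boundary misses B_r(p) and is otherwise at most |σ|/dist(p, S)
(`IsGeneralizedBoundary.monotonicity`). By Young's inequality A differs from the mass ratio by δ
times that ratio plus C(δ) times the energy in the ball (`abs_monoQuantity_sub_massRatio_le`). Hence
A is bounded below near zero and has a limit, points carry no mass, the energy of shrinking balls
tends to zero, and the mass ratio has the same limit as A. Since A(ρ) dominates the density,
comparing balls with nearby centres gives upper semicontinuity, and a large radius gives the bound.

Completing the square needs H orthogonal to the tangent plane, which has to be extracted from the
curvature identity (`IsCurvatureVarifold.ae_perp`). Differentiating P² = P shows that each matrix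
A_m = (A_{mij}) satisfies A_m = A_m P + P A_m, so P A_m P = 0. One also needs P_{li} A_{ijk} =
A_{ljk}, proved with rapidly oscillating test functions: their P-derivative is of order one along
the graph of the tangent plane field while their size is at most ε times a fixed function, so the
boundary measure ∂V, which need not live on that graph, drops out in the limit.

For the representation, blow-up at a point with an approximate tangent plane identifies the density
with the multiplicity, so the original carrier lies in the new set up to a null set. Conversely, the
points of density at least 1/2 off the carrier form a μ_V-null set on which balls have at least
quadratic mass, and a Vitali covering makes such a set ℋ²-null. Closedness is upper semicontinuity.
-/

/-! ### Compactness of the Grassmannian and integrability over cylinders -/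

theorem sum_sq_entries (P : G23) : ∑ i, ∑ j, P.1 i j ^ 2 = 2 := by
  obtain ⟨hs, hi, ht⟩ := P.2
  rw [← ht]
  refine Finset.sum_congr rfl fun i _ => ?_
  rw [← hi i i]
  refine Finset.sum_congr rfl fun j _ => ?_
  rw [hs j i, sq]

theorem abs_entry_le (P : G23) (i j : Fin 3) : |P.1 i j| ≤ 2 := by
  have h : P.1 i j ^ 2 ≤ 2 := by
    rw [← sum_sq_entries P]
    calc P.1 i j ^ 2 ≤ ∑ j, P.1 i j ^ 2 :=
          Finset.single_le_sum (f := fun j => P.1 i j ^ 2) (fun _ _ => sq_nonneg _)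
            (Finset.mem_univ j)
      _ ≤ _ := Finset.single_le_sum (f := fun i => ∑ j, P.1 i j ^ 2)
            (fun _ _ => Finset.sum_nonneg fun _ _ => sq_nonneg _) (Finset.mem_univ i)
  exact abs_le_of_sq_le_sq (by linarith) (by norm_num)

theorem isCompact_G23 : IsCompact G23 := by
  refine Metric.isCompact_of_isClosed_isBounded ?_ ?_
  · have h : G23 = (⋂ i, ⋂ j, {P : Mat3 | P i j = P j i}) ∩
        ((⋂ i, ⋂ j, {P : Mat3 | ∑ k, P i k * P k j = P i j}) ∩ {P : Mat3 | ∑ i, P i i = 2}) := by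
      ext P
      simp [G23]
    rw [h]
    refine IsClosed.inter (isClosed_iInter fun i => isClosed_iInter fun j =>
      isClosed_eq (by fun_prop) (by fun_prop)) (IsClosed.inter (isClosed_iInter fun i =>
      isClosed_iInter fun j => isClosed_eq (by fun_prop) (by fun_prop))
      (isClosed_eq (by fun_prop) (by fun_prop)))
  · refine (Metric.isBounded_closedBall (x := (0 : Mat3)) (r := 2)).subset fun P hP => ?_
    rw [mem_closedBall_zero_iff, pi_norm_le_iff_of_nonneg (by norm_num)]
    intro i
    rw [pi_norm_le_iff_of_nonneg (by norm_num)]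
    exact fun j => abs_entry_le ⟨P, hP⟩ i j

instance : CompactSpace G23 := isCompact_iff_compactSpace.mp isCompact_G23

theorem continuous_entry (i j : Fin 3) : Continuous fun z : GBundle => z.2.1 i j :=
  (continuous_apply_apply i j).comp (continuous_subtype_val.comp continuous_snd)

theorem continuous_incl : Continuous incl := by
  unfold incl; fun_prop

/-- Because the fibre is compact, compact support in the base variable alone yields every
integrability statement about test functions. -/
theorem isCompact_cylinder {C : Set E3} (hC : IsCompact C) :
    IsCompact {z : GBundle | z.1 ∈ C} := by
  have : {z : GBundle | z.1 ∈ C} = C ×ˢ univ := by ext; simp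
  rw [this]
  exact hC.prod isCompact_univ

theorem hasCompactSupport_of_cylinder {u : GBundle → ℝ} {C : Set E3} (hC : IsCompact C)
    (h : ∀ z : GBundle, z.1 ∉ C → u z = 0) : HasCompactSupport u :=
  HasCompactSupport.intro (isCompact_cylinder hC) h

/-- A continuous function vanishing outside a cylinder over a compact set times a locally integrable
function is integrable. -/
theorem integrable_mul_of_cylinder {V : Measure GBundle} {u f : GBundle → ℝ} {C : Set E3}
    (hC : IsCompact C) (hu : Continuous u) (h : ∀ z : GBundle, z.1 ∉ C → u z = 0)
    (hf : LocallyIntegrable f V) : Integrable (fun z => u z * f z) V :=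
  hf.integrable_smul_left_of_hasCompactSupport hu (hasCompactSupport_of_cylinder hC h)

theorem integrable_of_cylinder {V : Measure GBundle} [IsLocallyFiniteMeasure V] {u : GBundle → ℝ}
    {C : Set E3} (hC : IsCompact C) (hu : Continuous u) (h : ∀ z : GBundle, z.1 ∉ C → u z = 0) :
    Integrable u V :=
  hu.integrable_of_hasCompactSupport (hasCompactSupport_of_cylinder hC h)

theorem locallyFinite_weight (V : Measure GBundle) [IsLocallyFiniteMeasure V] :
    IsLocallyFiniteMeasure (weight V) := by
  refine ⟨fun x => ⟨Metric.closedBall x 1, Metric.closedBall_mem_nhds x one_pos, ?_⟩⟩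
  rw [weight, Measure.map_apply measurable_fst measurableSet_closedBall]
  exact (isCompact_cylinder (isCompact_closedBall x 1)).measure_lt_top

/-! ### Integer rectifiable varifolds as graph measures -/

theorem IsIntegerRectifiable.weight_eq {V : Measure GBundle} {M : Set E3} {θ : E3 → ℝ}
    (h : IsIntegerRectifiable V M θ) : weight V =
      ((μHE[2] : Measure E3).restrict M).withDensity (fun x => ENNReal.ofReal (θ x)) := by
  obtain ⟨-, -, -, -, T, hT, -, hV⟩ := h
  have hT' : AEMeasurable T (((μHE[2] : Measure E3).restrict M).withDensity
    (fun x => ENNReal.ofReal (θ x))) := hT.mono_ac (withDensity_absolutelyContinuous _ _)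
  have hG : AEMeasurable (fun x => (x, T x)) (((μHE[2] : Measure E3).restrict M).withDensity
    (fun x => ENNReal.ofReal (θ x))) := aemeasurable_id.prodMk hT'
  rw [weight, hV, AEMeasurable.map_map_of_aemeasurable measurable_fst.aemeasurable hG]
  exact Measure.map_id

/-- An integer rectifiable varifold is carried by the graph of its tangent plane field. -/
theorem IsIntegerRectifiable.exists_graph {V : Measure GBundle} {M : Set E3} {θ : E3 → ℝ}
    (h : IsIntegerRectifiable V M θ) : ∃ T : E3 → G23, AEMeasurable T (weight V) ∧
      V = (weight V).map (fun x => (x, T x)) := by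
  have hw := h.weight_eq
  obtain ⟨-, -, -, -, T, hT, -, hV⟩ := h
  refine ⟨T, ?_, ?_⟩
  · rw [hw]
    exact hT.mono_ac (withDensity_absolutelyContinuous _ _)
  · rw [hw]
    exact hV

/-- A locally integrable function on a varifold carried by a graph vanishes almost everywhere if all
its integrals against test functions of the base point vanish. -/
theorem ae_eq_zero_of_graph {V : Measure GBundle} [IsLocallyFiniteMeasure V] {T : E3 → G23}
    (hT : AEMeasurable T (weight V)) (hV : V = (weight V).map (fun x => (x, T x)))
    {f : GBundle → ℝ} (hf : LocallyIntegrable f V)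
    (h : ∀ ψ : E3 → ℝ, ContDiff ℝ 1 ψ → HasCompactSupport ψ → ∫ z, ψ z.1 * f z ∂V = 0) :
    ∀ᵐ z ∂V, f z = 0 := by
  have hG : AEMeasurable (fun x => (x, T x)) (weight V) := aemeasurable_id.prodMk hT
  have := locallyFinite_weight V
  have hfm : AEStronglyMeasurable f ((weight V).map (fun x => (x, T x))) :=
    hV ▸ hf.aestronglyMeasurable
  have hloc : LocallyIntegrable (fun x => f (x, T x)) (weight V) := by
    rw [locallyIntegrable_iff]
    intro K hK
    have h1 : IntegrableOn f {z : GBundle | z.1 ∈ K} V :=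
      hf.integrableOn_isCompact (isCompact_cylinder hK)
    have hKm : MeasurableSet {z : GBundle | z.1 ∈ K} :=
      (isCompact_cylinder hK).isClosed.measurableSet
    have h2 : IntegrableOn f {z : GBundle | z.1 ∈ K} ((weight V).map (fun x => (x, T x))) :=
      hV ▸ h1
    rw [← integrable_indicator_iff hKm] at h2
    have h3 := h2.comp_aemeasurable hG
    rw [← integrable_indicator_iff hK.isClosed.measurableSet]
    refine h3.congr (Eventually.of_forall fun x => ?_)
    by_cases hx : x ∈ K <;> simp [indicator, hx]
  have key := ae_eq_zero_of_integral_contDiff_smul_eq_zero hloc (fun g hg hgs => by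
    have h1 := h g (hg.of_le (by exact_mod_cast le_top)) hgs
    rw [hV, integral_map hG] at h1
    · exact h1
    · exact ((hg.continuous.comp continuous_fst).aestronglyMeasurable).mul hfm)
  -- `ae_map_iff` needs a measurable set, hence the strongly measurable representative of f.
  obtain ⟨f', hf', e⟩ := hf.aestronglyMeasurable
  have e' : ∀ᵐ z ∂((weight V).map (fun x => (x, T x))), f z = f' z := by
    rw [← hV]; exact e
  have h0 : ∀ᵐ z ∂((weight V).map (fun x => (x, T x))), f' z = 0 := by
    have hm : MeasurableSet {z | f' z = 0} := hf'.measurable (measurableSet_singleton 0)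
    rw [ae_map_iff hG hm]
    filter_upwards [key, ae_of_ae_map hG e'] with x h1 h2
    rw [← h2, h1]
  rw [← hV] at h0
  filter_upwards [e, h0] with z h1 h2
  rw [h1, h2]

/-- Smooth functions approximating a bounded measurable function almost everywhere on a compact
set. -/
theorem exists_contDiff_tendsto_ae {m : Measure E3} [IsLocallyFiniteMeasure m] {τ : E3 → ℝ}
    (hτ : AEStronglyMeasurable τ m) {b : ℝ} (hb : ∀ x, |τ x| ≤ b) {C : Set E3}
    (hC : IsCompact C) : ∃ g : ℕ → E3 → ℝ, (∀ n, ContDiff ℝ 1 (g n)) ∧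
      ∀ᵐ x ∂(m.restrict C), Tendsto (fun n => g n x) atTop (𝓝 (τ x)) := by
  have : IsFiniteMeasure (m.restrict C) := ⟨by
    rw [Measure.restrict_apply_univ]; exact hC.measure_lt_top⟩
  have hmem : MemLp τ 1 (m.restrict C) :=
    MemLp.of_bound hτ.restrict b (Eventually.of_forall hb)
  choose g h1 h2 h3 using fun n : ℕ => hmem.exist_eLpNorm_sub_le ENNReal.one_ne_top le_rfl
    (ε := 1 / ((n : ℝ) + 1)) (by positivity)
  have hlim : Tendsto (fun n => eLpNorm (g n - τ) 1 (m.restrict C)) atTop (𝓝 0) := by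
    have h0 : Tendsto (fun n : ℕ => ENNReal.ofReal (1 / ((n : ℝ) + 1))) atTop (𝓝 0) := by
      rw [← ENNReal.ofReal_zero]
      exact ENNReal.tendsto_ofReal tendsto_one_div_add_atTop_nhds_zero_nat
    refine tendsto_of_tendsto_of_tendsto_of_le_of_le tendsto_const_nhds h0
      (fun _ => zero_le) (fun n => ?_)
    dsimp only
    rw [eLpNorm_sub_comm]
    exact h3 n
  obtain ⟨ns, -, hns⟩ := (tendstoInMeasure_of_tendsto_eLpNorm one_ne_zero
    (fun n => (h2 n).continuous.aestronglyMeasurable) hmem.1 hlim).exists_seq_tendsto_ae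
  exact ⟨fun n => g (ns n), fun n => (h2 _).of_le (by exact_mod_cast le_top), hns⟩

/-! ### Calculus of test functions on ℝ³ × ℝ^{3×3} -/

/-- The matrix entry `P_{jk}` as a continuous linear functional on `ℝ³ × ℝ^{3×3}`. -/
noncomputable def entryCLM (j k : Fin 3) : (E3 × Mat3) →L[ℝ] ℝ :=
  ((ContinuousLinearMap.proj (R := ℝ) (φ := fun _ : Fin 3 => ℝ) k).comp
    (ContinuousLinearMap.proj (R := ℝ) (φ := fun _ : Fin 3 => Fin 3 → ℝ) j)).comp
      (ContinuousLinearMap.snd ℝ E3 Mat3)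

@[simp] theorem entryCLM_apply (j k : Fin 3) (z : E3 × Mat3) : entryCLM j k z = z.2 j k := rfl

theorem dx_mul {φ χ : E3 × Mat3 → ℝ} (hφ : ContDiff ℝ 1 φ) (hχ : ContDiff ℝ 1 χ) (j : Fin 3)
    (z : E3 × Mat3) : dx (fun y => φ y * χ y) j z = φ z * dx χ j z + χ z * dx φ j z := by
  have := fderiv_fun_mul (hφ.differentiable one_ne_zero z) (hχ.differentiable one_ne_zero z)
  simp [dx, this]

theorem dP_mul {φ χ : E3 × Mat3 → ℝ} (hφ : ContDiff ℝ 1 φ) (hχ : ContDiff ℝ 1 χ) (j k : Fin 3)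
    (z : E3 × Mat3) : dP (fun y => φ y * χ y) j k z = φ z * dP χ j k z + χ z * dP φ j k z := by
  have := fderiv_fun_mul (hφ.differentiable one_ne_zero z) (hχ.differentiable one_ne_zero z)
  simp [dP, this]

theorem dx_entry (l i j : Fin 3) (z : E3 × Mat3) : dx (fun y => y.2 l i) j z = 0 := by
  have : fderiv ℝ (fun y : E3 × Mat3 => y.2 l i) z = entryCLM l i := (entryCLM l i).fderiv
  simp [dx, this]

theorem dP_entry (l i j k : Fin 3) (z : E3 × Mat3) :
    dP (fun y => y.2 l i) j k z = if l = j ∧ i = k then 1 else 0 := by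
  have : fderiv ℝ (fun y : E3 × Mat3 => y.2 l i) z = entryCLM l i := (entryCLM l i).fderiv
  simp only [dP, this, entryCLM_apply]
  by_cases h : l = j
  · subst h
    by_cases h' : i = k
    · subst h'; simp
    · simp [h']
  · simp [h]

theorem contDiff_entry (l i : Fin 3) : ContDiff ℝ 1 (fun y : E3 × Mat3 => y.2 l i) :=
  (entryCLM l i).contDiff

theorem dP_base {ψ : E3 → ℝ} (hψ : ContDiff ℝ 1 ψ) (j k : Fin 3) (z : E3 × Mat3) :
    dP (fun y => ψ y.1) j k z = 0 := by
  have h := ((hψ.differentiable one_ne_zero z.1).hasFDerivAt.comp z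
    (hasFDerivAt_fst (𝕜 := ℝ) (E := E3) (F := Mat3))).fderiv
  have h' : (ψ ∘ Prod.fst : E3 × Mat3 → ℝ) = fun y => ψ y.1 := rfl
  rw [h'] at h
  simp [dP, h]

theorem continuous_dx {φ : E3 × Mat3 → ℝ} (hφ : ContDiff ℝ 1 φ) (j : Fin 3) :
    Continuous (dx φ j) :=
  (hφ.continuous_fderiv one_ne_zero).clm_apply continuous_const

theorem continuous_dP {φ : E3 × Mat3 → ℝ} (hφ : ContDiff ℝ 1 φ) (j k : Fin 3) :
    Continuous (dP φ j k) :=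
  (hφ.continuous_fderiv one_ne_zero).clm_apply continuous_const

/-- The data common to all test functions: they vanish, with their derivatives, off a cylinder over
a compact set. -/
theorem IsTest.exists_compact {φ : E3 × Mat3 → ℝ} (hφ : IsTest φ) : ∃ C : Set E3, IsCompact C ∧
    (∀ x ∉ C, ∀ P, φ (x, P) = 0) ∧ (∀ x ∉ C, ∀ P j, dx φ j (x, P) = 0) ∧
    (∀ x ∉ C, ∀ P j k, dP φ j k (x, P) = 0) := by
  obtain ⟨h, C, hC, h0⟩ := hφ
  have key : ∀ x ∉ C, ∀ P, fderiv ℝ φ (x, P) = 0 := by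
    intro x hx P
    have : φ =ᶠ[𝓝 (x, P)] fun _ => 0 := by
      have hU : {y : E3 × Mat3 | y.1 ∉ C} ∈ 𝓝 (x, P) :=
        (hC.isClosed.isOpen_compl.preimage continuous_fst).mem_nhds hx
      filter_upwards [hU] with y hy using h0 y.1 hy y.2
    rw [this.fderiv_eq]
    simp
  exact ⟨C, hC, h0, fun x hx P j => by simp [dx, key x hx P],
    fun x hx P j k => by simp [dP, key x hx P]⟩

theorem isTest_base_mul {ψ : E3 → ℝ} (hψ : ContDiff ℝ 1 ψ) (hs : HasCompactSupport ψ)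
    {Q : E3 × Mat3 → ℝ} (hQ : ContDiff ℝ 1 Q) : IsTest (fun y => ψ y.1 * Q y) := by
  refine ⟨(hψ.comp contDiff_fst).mul hQ, tsupport ψ, hs, fun x hx P => ?_⟩
  simp [image_eq_zero_of_notMem_tsupport hx]

theorem IsTest.entry_mul {φ : E3 × Mat3 → ℝ} (hφ : IsTest φ) (l i : Fin 3) :
    IsTest (fun y => y.2 l i * φ y) := by
  obtain ⟨h, C, hC, h0⟩ := hφ
  exact ⟨(contDiff_entry l i).mul h, C, hC, fun x hx P => by simp [h0 x hx P]⟩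

section Curvature

variable {V : Measure GBundle}

theorem IsTest.integrable_mul {φ : E3 × Mat3 → ℝ} (hφ : IsTest φ) {f : GBundle → ℝ}
    (hf : LocallyIntegrable f V) : Integrable (fun z => φ (incl z) * f z) V := by
  obtain ⟨C, hC, h0, -, -⟩ := hφ.exists_compact
  exact integrable_mul_of_cylinder hC (hφ.1.continuous.comp continuous_incl)
    (fun z hz => h0 _ hz _) hf

theorem IsTest.integrable_dP_mul {φ : E3 × Mat3 → ℝ} (hφ : IsTest φ) {f : GBundle → ℝ}
    (hf : LocallyIntegrable f V) (j k : Fin 3) :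
    Integrable (fun z => dP φ j k (incl z) * f z) V := by
  obtain ⟨C, hC, -, -, h0⟩ := hφ.exists_compact
  exact integrable_mul_of_cylinder hC ((continuous_dP hφ.1 j k).comp continuous_incl)
    (fun z hz => h0 _ hz _ j k) hf

theorem IsTest.integrable_dx [IsLocallyFiniteMeasure V] {φ : E3 × Mat3 → ℝ} (hφ : IsTest φ)
    (i j : Fin 3) :
    Integrable (fun z : GBundle => z.2.1 i j * dx φ j (incl z)) V := by
  obtain ⟨C, hC, -, h0, -⟩ := hφ.exists_compact
  refine integrable_of_cylinder hC
    ((continuous_entry i j).mul ((continuous_dx hφ.1 j).comp continuous_incl)) (fun z hz => ?_)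
  rw [show dx φ j (incl z) = 0 from h0 _ hz _ j, mul_zero]

theorem locallyIntegrable_continuous_mul {f u : GBundle → ℝ} (hf : LocallyIntegrable f V)
    (hu : Continuous u) : LocallyIntegrable (fun z => u z * f z) V := by
  rw [locallyIntegrable_iff] at hf ⊢
  exact fun K hK => (hf K hK).continuousOn_mul hu.continuousOn hK

end Curvature

/-! ### Tangency of the curvature functions to the Grassmannian -/

section Tangent

variable {V : Measure GBundle} [IsLocallyFiniteMeasure V] {T : E3 → G23}
  {A : Fin 3 → Fin 3 → Fin 3 → GBundle → ℝ} {bd : RadonVectorMeasure GBundle}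

/-- The curvature functions are tangent to the Grassmannian. -/
theorem IsCurvatureVarifold.ae_tangent (hT : AEMeasurable T (weight V))
    (hV : V = (weight V).map (fun x => (x, T x))) (h : IsCurvatureVarifold V A bd)
    {Q : E3 × Mat3 → ℝ} (hQ : ContDiff ℝ 1 Q) (hx : ∀ z j, dx Q j z = 0)
    (h0 : ∀ z : GBundle, Q (incl z) = 0) (i : Fin 3) :
    ∀ᵐ z ∂V, ∑ j, ∑ k, A i j k z * dP Q j k (incl z) = 0 := by
  refine ae_eq_zero_of_graph hT hV ?_ ?_
  · refine locallyIntegrable_finsetSum _ fun j _ => locallyIntegrable_finsetSum _ fun k _ => ?_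
    simp_rw [mul_comm (A i j k _)]
    exact locallyIntegrable_continuous_mul (h.1 i j k) ((continuous_dP hQ j k).comp continuous_incl)
  · intro ψ hψ hs
    -- The test function ψQ vanishes on G₂(ℝ³), which kills both right-hand terms and the
    -- x-derivative; only ψ times the P-derivative of Q survives.
    have hψ' : ContDiff ℝ 1 (fun y : E3 × Mat3 => ψ y.1) := hψ.comp contDiff_fst
    have := h.2 _ (isTest_base_mul hψ hs hQ) i
    simp only [h0, mul_zero, zero_mul, integral_zero, neg_zero, add_zero, dx_mul hψ' hQ,
      dP_mul hψ' hQ, hx, Finset.sum_const_zero, zero_add] at this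
    rw [← this]
    refine integral_congr_ae (Eventually.of_forall fun z => ?_)
    simp only [Finset.mul_sum, incl]
    refine Finset.sum_congr rfl fun j _ => Finset.sum_congr rfl fun k _ => ?_
    ring

/-- Tangency applied to the defining relation Q = (P²)_{ab} - P_{ab}: the fixed-i matrix A_i obeys
the Leibniz rule A = AP + PA. -/
theorem IsCurvatureVarifold.ae_leibniz (hT : AEMeasurable T (weight V))
    (hV : V = (weight V).map (fun x => (x, T x))) (h : IsCurvatureVarifold V A bd)
    (i a b : Fin 3) : ∀ᵐ z ∂V,
      A i a b z = ∑ r, (A i a r z * z.2.1 r b + z.2.1 a r * A i r b z) := by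
  let q : Fin 3 → E3 × Mat3 → ℝ := fun r y => y.2 a r * y.2 r b
  have hq : q = fun r y => y.2 a r * y.2 r b := rfl
  have hqc : ∀ r, ContDiff ℝ 1 (q r) := fun r => (contDiff_entry a r).mul (contDiff_entry r b)
  have hQ : ContDiff ℝ 1 (fun y : E3 × Mat3 => ∑ r, q r y - y.2 a b) :=
    (ContDiff.sum fun r _ => hqc r).sub (contDiff_entry a b)
  have hf : ∀ z, fderiv ℝ (fun y : E3 × Mat3 => ∑ r, q r y - y.2 a b) z =
      ∑ r, fderiv ℝ (q r) z - fderiv ℝ (fun y : E3 × Mat3 => y.2 a b) z := by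
    intro z
    rw [fderiv_fun_sub, fderiv_fun_sum]
    · exact fun r _ => (hqc r).differentiable one_ne_zero z
    · exact (ContDiff.sum fun r _ => hqc r).differentiable one_ne_zero z
    · exact (contDiff_entry a b).differentiable one_ne_zero z
  have e1 : ∀ z j, dx (fun y : E3 × Mat3 => ∑ r, q r y - y.2 a b) j z =
      ∑ r, dx (q r) j z - dx (fun y : E3 × Mat3 => y.2 a b) j z := by
    intro z j; simp only [dx, hf]; simp
  have e2 : ∀ z j k, dP (fun y : E3 × Mat3 => ∑ r, q r y - y.2 a b) j k z =
      ∑ r, dP (q r) j k z - dP (fun y : E3 × Mat3 => y.2 a b) j k z := by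
    intro z j k; simp only [dP, hf]; simp
  filter_upwards [h.ae_tangent hT hV hQ (fun z j => by
    rw [e1]
    simp [hq, dx_mul (contDiff_entry _ _) (contDiff_entry _ _), dx_entry])
    (fun z => sub_eq_zero.mpr (z.2.2.2.1 a b)) i] with z hz
  simp only [e2] at hz
  simp only [hq, dP_mul (contDiff_entry _ _) (contDiff_entry _ _), dP_entry, mul_sub,
    Finset.sum_sub_distrib, mul_ite, mul_one, mul_zero, ite_and,
    Finset.sum_ite_eq, Finset.mem_univ, if_true, Finset.sum_ite_irrel, Finset.sum_const_zero,
    incl, Finset.mul_sum, mul_add, Finset.sum_add_distrib] at hz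
  have e3 : ∀ f : Fin 3 → Fin 3 → Fin 3 → ℝ, ∑ j, ∑ k, ∑ r, f j k r = ∑ r, ∑ j, ∑ k, f j k r := by
    intro f
    simp only [Fin.sum_univ_three]; ring
  rw [e3] at hz
  simp only [Finset.sum_ite_eq, Finset.sum_ite_eq', Finset.mem_univ, if_true,
    Finset.sum_ite_irrel, Finset.sum_const_zero] at hz
  rw [Finset.sum_add_distrib]
  simp only [mul_comm (z.2.1 a _)]
  linarith

end Tangent

theorem RadonVectorMeasure.locallyIntegrable_dir (bd : RadonVectorMeasure GBundle) (i : Fin 3) :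
    LocallyIntegrable (fun z => bd.dir z i) bd.tv := by
  have := bd.locallyFinite
  refine (locallyIntegrable_const (1 : ℝ)).mono ?_ ?_
  · exact ((EuclideanSpace.proj (𝕜 := ℝ) i).measurable.comp bd.measurable_dir).aestronglyMeasurable
  · filter_upwards [bd.norm_dir] with z hz
    simpa [hz] using PiLp.norm_apply_le (bd.dir z) i

/-! ### Tangentiality of the first index and orthogonality of the mean curvature -/

section FirstIndex

variable {V : Measure GBundle} [IsLocallyFiniteMeasure V] {T : E3 → G23}
  {A : Fin 3 → Fin 3 → Fin 3 → GBundle → ℝ} {bd : RadonVectorMeasure GBundle}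

/-- Inserting P_{li}φ in the i-th equation, summing over i and subtracting the l-th equation for φ
cancels the x-derivatives, since P_{li}P_{ij} = P_{lj}; the extra term comes from differentiating
P_{li}. -/
theorem first_index_pointwise (A : Fin 3 → Fin 3 → Fin 3 → GBundle → ℝ) {φ : E3 × Mat3 → ℝ}
    (hφ : IsTest φ) (l : Fin 3) (z : GBundle) :
    (∑ i, ((∑ j, z.2.1 i j * dx (fun y => y.2 l i * φ y) j (incl z)) +
      ∑ j, ∑ k, A i j k z * dP (fun y => y.2 l i * φ y) j k (incl z))) -
      ((∑ j, z.2.1 l j * dx φ j (incl z)) + ∑ j, ∑ k, A l j k z * dP φ j k (incl z)) =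
    (∑ j, ∑ k, dP φ j k (incl z) * (∑ i, z.2.1 l i * A i j k z - A l j k z)) +
      φ (incl z) * ∑ i, A i l i z := by
  have hid : ∀ j, ∑ i, z.2.1 l i * z.2.1 i j = z.2.1 l j := fun j => z.2.2.2.1 l j
  have h1 : ∀ i, ∑ j, ∑ k, A i j k z * dP (fun y => y.2 l i * φ y) j k (incl z) =
      z.2.1 l i * (∑ j, ∑ k, A i j k z * dP φ j k (incl z)) + φ (incl z) * A i l i z := by
    intro i
    simp only [dP_mul (contDiff_entry _ _) hφ.1, dP_entry, mul_add, Finset.sum_add_distrib,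
      mul_ite, mul_one, mul_zero, ite_and, Finset.sum_ite_eq, Finset.mem_univ, if_true,
      Finset.sum_ite_irrel, Finset.sum_const_zero, Finset.mul_sum]
    congr 1
    · exact Finset.sum_congr rfl fun j _ => Finset.sum_congr rfl fun k _ => by
        simp only [incl]; ring
    · ring
  simp only [h1, dx_mul (contDiff_entry _ _) hφ.1, dx_entry, mul_zero, add_zero]
  simp only [Fin.sum_univ_three] at hid ⊢
  simp only [incl]
  linear_combination dx φ 0 (z.1, z.2.1) * hid 0 + dx φ 1 (z.1, z.2.1) * hid 1 +
    dx φ 2 (z.1, z.2.1) * hid 2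

theorem IsTest.integrable_integrand (h : IsCurvatureVarifold V A bd) {φ : E3 × Mat3 → ℝ}
    (hφ : IsTest φ) (i : Fin 3) :
    Integrable (fun z => (∑ j, z.2.1 i j * dx φ j (incl z)) +
      ∑ j, ∑ k, A i j k z * dP φ j k (incl z)) V := by
  refine (integrable_finsetSum _ fun j _ => hφ.integrable_dx i j).add
    (integrable_finsetSum _ fun j _ => integrable_finsetSum _ fun k _ => ?_)
  simp_rw [mul_comm (A i j k _)]
  exact hφ.integrable_dP_mul (h.1 i j k) j k

/-- The extra term φ A_{ili} of the pointwise computation cancels the mean curvature term of the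
l-th equation. What matters is that the right-hand side contains φ but no derivative of φ. -/
theorem IsCurvatureVarifold.first_index_identity (h : IsCurvatureVarifold V A bd)
    {φ : E3 × Mat3 → ℝ} (hφ : IsTest φ) (l : Fin 3) :
    ∫ z, ∑ j, ∑ k, dP φ j k (incl z) * (∑ i, z.2.1 l i * A i j k z - A l j k z) ∂V =
      ∫ z, φ (incl z) * -∑ i, z.2.1 l i * ∑ j, A j i j z ∂V +
        ∫ z, φ (incl z) * (∑ i, z.2.1 l i * bd.dir z i - bd.dir z l) ∂bd.tv := by
  have e := fun i => h.2 _ (hφ.entry_mul l i) i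
  have e' := h.2 φ hφ l
  have hI := fun i => (hφ.entry_mul l i).integrable_integrand h i
  have hI' := hφ.integrable_integrand h l
  have hH : ∀ i, LocallyIntegrable (fun z => ∑ j, A j i j z) V := fun i =>
    locallyIntegrable_finsetSum _ fun j _ => h.1 j i j
  have key : ∫ z, ((∑ i, ((∑ j, z.2.1 i j * dx (fun y => y.2 l i * φ y) j (incl z)) +
      ∑ j, ∑ k, A i j k z * dP (fun y => y.2 l i * φ y) j k (incl z))) -
      ((∑ j, z.2.1 l j * dx φ j (incl z)) + ∑ j, ∑ k, A l j k z * dP φ j k (incl z))) ∂V =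
      ∫ z, ((∑ j, ∑ k, dP φ j k (incl z) * (∑ i, z.2.1 l i * A i j k z - A l j k z)) +
      φ (incl z) * ∑ i, A i l i z) ∂V :=
    integral_congr_ae (Eventually.of_forall fun z => first_index_pointwise A hφ l z)
  have hB : Integrable (fun z => ∑ j, ∑ k,
      dP φ j k (incl z) * (∑ i, z.2.1 l i * A i j k z - A l j k z)) V :=
    integrable_finsetSum _ fun j _ => integrable_finsetSum _ fun k _ =>
      hφ.integrable_dP_mul ((locallyIntegrable_finsetSum _ fun i _ =>
        locallyIntegrable_continuous_mul (h.1 i j k) (continuous_entry l i)).sub (h.1 l j k)) j k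
  rw [integral_sub (integrable_finsetSum _ fun i _ => hI i) hI',
    integral_finsetSum _ (fun i _ => hI i), integral_add hB (hφ.integrable_mul (hH l)), e'] at key
  simp only [e] at key
  have f1 : ∑ i, ∫ z, (incl z).2 l i * φ (incl z) * ∑ j, A j i j z ∂V =
      ∫ z, φ (incl z) * ∑ i, z.2.1 l i * ∑ j, A j i j z ∂V := by
    rw [← integral_finsetSum _ (fun i _ => (hφ.entry_mul l i).integrable_mul (hH i))]
    refine integral_congr_ae (Eventually.of_forall fun z => ?_)
    simp only [incl]
    rw [Finset.mul_sum]
    exact Finset.sum_congr rfl fun i _ => by ring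
  have f2 : ∫ z, φ (incl z) * (∑ i, z.2.1 l i * bd.dir z i - bd.dir z l) ∂bd.tv =
      ∑ i, ∫ z, (incl z).2 l i * φ (incl z) * bd.dir z i ∂bd.tv -
        ∫ z, φ (incl z) * bd.dir z l ∂bd.tv := by
    rw [← integral_finsetSum _ (fun i _ =>
      (hφ.entry_mul l i).integrable_mul (bd.locallyIntegrable_dir i)),
      ← integral_sub (integrable_finsetSum _ fun i _ =>
        (hφ.entry_mul l i).integrable_mul (bd.locallyIntegrable_dir i))
        (hφ.integrable_mul (bd.locallyIntegrable_dir l))]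
    refine integral_congr_ae (Eventually.of_forall fun z => ?_)
    simp only [incl]
    rw [mul_sub, Finset.mul_sum]
    congr 1
    exact Finset.sum_congr rfl fun i _ => by ring
  rw [f2]
  simp only [mul_neg, integral_neg]
  rw [← f1]
  simp only [Finset.sum_add_distrib, Finset.sum_neg_distrib] at key
  linarith

/-- This oscillating factor is at most ε everywhere, yet its P_{ab}-derivative is cos((P_{ab} -
g)/ε), close to 1 where g approximates P_{ab}. -/
theorem contDiff_sin_bump {g : E3 → ℝ} (hg : ContDiff ℝ 1 g) (a b : Fin 3) (ε : ℝ) :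
    ContDiff ℝ 1 (fun y : E3 × Mat3 => ε * Real.sin ((y.2 a b - g y.1) / ε)) :=
  contDiff_const.mul (Real.contDiff_sin.comp
    (((contDiff_entry a b).sub (hg.comp contDiff_fst)).div_const ε))

theorem dP_sin_bump {g : E3 → ℝ} (hg : ContDiff ℝ 1 g) (a b j k : Fin 3) {ε : ℝ} (hε : ε ≠ 0)
    (z : E3 × Mat3) :
    dP (fun y : E3 × Mat3 => ε * Real.sin ((y.2 a b - g y.1) / ε)) j k z =
      Real.cos ((z.2 a b - g z.1) / ε) * if a = j ∧ b = k then 1 else 0 := by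
  have h1 : HasFDerivAt (fun y : E3 × Mat3 => y.2 a b) (entryCLM a b) z :=
    (entryCLM a b).hasFDerivAt
  have h2 := (hg.differentiable one_ne_zero z.1).hasFDerivAt.comp z
    (hasFDerivAt_fst (𝕜 := ℝ) (E := E3) (F := Mat3))
  have h3 := (((h1.sub h2).mul_const ε⁻¹).sin).const_mul ε
  have h4 := h3.fderiv
  have h5 := dP_entry a b j k z
  rw [dP, h1.fderiv] at h5
  simp only [Pi.sub_apply, Function.comp_apply, ← div_eq_mul_inv] at h4
  rw [dP, h4, ← h5]
  simp
  field_simp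

/-- The first index of the curvature functions is tangential. -/
theorem IsCurvatureVarifold.ae_first_index (hT : AEMeasurable T (weight V))
    (hV : V = (weight V).map (fun x => (x, T x))) (h : IsCurvatureVarifold V A bd)
    (l a b : Fin 3) : ∀ᵐ z ∂V, ∑ i, z.2.1 l i * A i a b z - A l a b z = 0 := by
  have hBl : ∀ j k, LocallyIntegrable (fun z => ∑ i, z.2.1 l i * A i j k z - A l j k z) V :=
    fun j k => (locallyIntegrable_finsetSum _ fun i _ =>
        locallyIntegrable_continuous_mul (h.1 i j k) (continuous_entry l i)).sub (h.1 l j k)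
  refine ae_eq_zero_of_graph hT hV (hBl a b) fun ψ hψ hs => ?_
  have hloc := locallyFinite_weight V
  have hψt : IsTest (fun y : E3 × Mat3 => ψ y.1) := by
    simpa using isTest_base_mul hψ hs (contDiff_const (c := (1 : ℝ)))
  -- a sequence approximating the tangent plane
  obtain ⟨g, hg, hlim⟩ : ∃ g : ℕ → E3 → ℝ, (∀ n, ContDiff ℝ 1 (g n)) ∧
      ∀ᵐ z ∂V, z.1 ∈ tsupport ψ → Tendsto (fun n => g n z.1) atTop (𝓝 (z.2.1 a b)) := by
    have hm : AEStronglyMeasurable (fun x => (T x).1 a b) (weight V) :=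
      ((continuous_apply_apply a b).comp continuous_subtype_val).measurable.comp_aemeasurable hT
        |>.aestronglyMeasurable
    obtain ⟨g, hg, hlim⟩ := exists_contDiff_tendsto_ae hm (b := 2)
      (fun x => abs_entry_le (T x) a b) (show IsCompact (tsupport ψ) from hs)
    refine ⟨g, hg, ?_⟩
    rw [ae_restrict_iff' hs.isClosed.measurableSet] at hlim
    have hms : MeasurableSet {z : GBundle | z.1 ∈ tsupport ψ →
        Tendsto (fun n => g n z.1) atTop (𝓝 (z.2.1 a b))} := by
      have h1 : MeasurableSet {z : GBundle | z.1 ∈ tsupport ψ} :=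
        (isCompact_cylinder hs).isClosed.measurableSet
      have h2 : MeasurableSet {z : GBundle | Tendsto (fun n => g n z.1 - z.2.1 a b) atTop (𝓝 0)} :=
        measurableSet_tendsto _ fun n =>
          (((hg n).continuous.comp continuous_fst).sub (continuous_entry a b)).measurable
      have : {z : GBundle | z.1 ∈ tsupport ψ →
          Tendsto (fun n => g n z.1) atTop (𝓝 (z.2.1 a b))} =
          {z : GBundle | z.1 ∈ tsupport ψ}ᶜ ∪
            {z : GBundle | Tendsto (fun n => g n z.1 - z.2.1 a b) atTop (𝓝 0)} := by
        ext z
        simp only [mem_ofPred_eq, mem_union, mem_compl_iff, tendsto_sub_nhds_zero_iff, imp_iff_not_or]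
      rw [this]
      exact h1.compl.union h2
    have : ∀ᵐ z ∂((weight V).map (fun x => (x, T x))), z.1 ∈ tsupport ψ →
        Tendsto (fun n => g n z.1) atTop (𝓝 (z.2.1 a b)) := by
      have hgr : AEMeasurable (fun x => (x, T x)) (weight V) := aemeasurable_id.prodMk hT
      rw [ae_map_iff hgr hms]
      exact hlim
    rwa [← hV] at this
  set F : GBundle → ℝ := fun z => -∑ i, z.2.1 l i * ∑ j, A j i j z with hF
  set G : GBundle → ℝ := fun z => ∑ i, z.2.1 l i * bd.dir z i - bd.dir z l with hG
  have hFl : LocallyIntegrable F V := (locallyIntegrable_finsetSum _ fun i _ =>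
    locallyIntegrable_continuous_mul (locallyIntegrable_finsetSum _ fun j _ =>
      h.1 j i j) (continuous_entry l i)).neg
  have hGl : LocallyIntegrable G bd.tv := (locallyIntegrable_finsetSum _ fun i _ =>
    locallyIntegrable_continuous_mul (bd.locallyIntegrable_dir i) (continuous_entry l i)).sub
      (bd.locallyIntegrable_dir l)
  -- Both right-hand integrals of the identity are at most ε times a constant independent of ε and
  -- of the approximation g n.
  set c : ℝ := ∫ z, ‖ψ z.1 * F z‖ ∂V + ∫ z, ‖ψ z.1 * G z‖ ∂bd.tv with hc
  have hbound : ∀ ε : ℝ, 0 < ε →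
      |∫ z, ψ z.1 * (∑ i, z.2.1 l i * A i a b z - A l a b z) ∂V| ≤ ε * c := by
    intro ε hε
    have hstep : ∀ n, |∫ z, ψ z.1 * Real.cos ((z.2.1 a b - g n z.1) / ε) *
        (∑ i, z.2.1 l i * A i a b z - A l a b z) ∂V| ≤ ε * c := by
      intro n
      have hφ := isTest_base_mul hψ hs (contDiff_sin_bump (hg n) a b ε)
      have hid := h.first_index_identity hφ l
      have e1 : ∀ z : GBundle, ∑ j, ∑ k, dP (fun y : E3 × Mat3 => ψ y.1 *
          (ε * Real.sin ((y.2 a b - g n y.1) / ε))) j k (incl z) *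
            (∑ i, z.2.1 l i * A i j k z - A l j k z) =
          ψ z.1 * Real.cos ((z.2.1 a b - g n z.1) / ε) *
            (∑ i, z.2.1 l i * A i a b z - A l a b z) := by
        intro z
        have : ∀ j k, dP (fun y : E3 × Mat3 => ψ y.1 *
          (ε * Real.sin ((y.2 a b - g n y.1) / ε))) j k (incl z) =
            if a = j ∧ b = k then ψ z.1 * Real.cos ((z.2.1 a b - g n z.1) / ε) else 0 := by
          intro j k
          rw [dP_mul (φ := fun y => ψ y.1) (hψ.comp contDiff_fst) (contDiff_sin_bump (hg n) a b ε),
            dP_sin_bump (hg n) a b j k hε.ne', dP_base hψ]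
          simp [incl]
        simp only [this, ite_mul, zero_mul, ite_and, Finset.sum_ite_eq, Finset.mem_univ, if_true,
          Finset.sum_ite_irrel, Finset.sum_const_zero]
      simp only [e1] at hid
      rw [hid]
      have hs1 : ∀ (x : E3) (t : ℝ), ‖ψ x * (ε * Real.sin t)‖ ≤ ε * ‖ψ x‖ := by
        intro x t
        rw [norm_mul, norm_mul, Real.norm_of_nonneg hε.le, Real.norm_eq_abs (Real.sin t)]
        have := Real.abs_sin_le_one t
        nlinarith [mul_nonneg hε.le (norm_nonneg (ψ x))]
      have b1 : ‖∫ z, (ψ (incl z).1 * (ε * Real.sin (((incl z).2 a b - g n (incl z).1) / ε))) *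
          F z ∂V‖ ≤ ε * ∫ z, ‖ψ z.1 * F z‖ ∂V := by
        rw [← integral_const_mul]
        refine norm_integral_le_of_norm_le ((hψt.integrable_mul hFl).norm.const_mul ε)
          (Eventually.of_forall fun z => ?_)
        rw [norm_mul, norm_mul (ψ z.1), ← mul_assoc ε]
        exact mul_le_mul_of_nonneg_right (hs1 _ _) (norm_nonneg _)
      have b2 : ‖∫ z, (ψ (incl z).1 * (ε * Real.sin (((incl z).2 a b - g n (incl z).1) / ε))) *
          G z ∂bd.tv‖ ≤ ε * ∫ z, ‖ψ z.1 * G z‖ ∂bd.tv := by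
        rw [← integral_const_mul]
        refine norm_integral_le_of_norm_le ((hψt.integrable_mul hGl).norm.const_mul ε)
          (Eventually.of_forall fun z => ?_)
        rw [norm_mul, norm_mul (ψ z.1), ← mul_assoc ε]
        exact mul_le_mul_of_nonneg_right (hs1 _ _) (norm_nonneg _)
      rw [hc, mul_add]
      exact (abs_add_le _ _).trans (add_le_add b1 b2)
    -- With ε fixed, n → ∞ first: on the graph g n tends to P_{ab}, so the cosine tends to 1. Only
    -- afterwards does ε tend to 0.
    have hcont : Tendsto (fun n => ∫ z, ψ z.1 * Real.cos ((z.2.1 a b - g n z.1) / ε) *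
        (∑ i, z.2.1 l i * A i a b z - A l a b z) ∂V) atTop
        (𝓝 (∫ z, ψ z.1 * (∑ i, z.2.1 l i * A i a b z - A l a b z) ∂V)) := by
      refine tendsto_integral_of_dominated_convergence
        (fun z => ‖ψ z.1 * (∑ i, z.2.1 l i * A i a b z - A l a b z)‖) (fun n => ?_)
        (hψt.integrable_mul (hBl a b)).norm (fun n => Eventually.of_forall fun z => ?_) ?_
      · refine AEStronglyMeasurable.mul ?_ (hBl a b).aestronglyMeasurable
        refine Continuous.aestronglyMeasurable ?_
        exact (hψ.continuous.comp continuous_fst).mul (Real.continuous_cos.comp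
          (((continuous_entry a b).sub ((hg n).continuous.comp continuous_fst)).div_const ε))
      · rw [norm_mul, norm_mul, norm_mul, Real.norm_eq_abs (Real.cos _)]
        refine mul_le_mul_of_nonneg_right ?_ (norm_nonneg _)
        exact mul_le_of_le_one_right (norm_nonneg _) (Real.abs_cos_le_one _)
      · filter_upwards [hlim] with z hz
        by_cases hzs : z.1 ∈ tsupport ψ
        · have h1 : Tendsto (fun n => Real.cos ((z.2.1 a b - g n z.1) / ε)) atTop (𝓝 1) := by
            have h2 : Tendsto (fun n => (z.2.1 a b - g n z.1) / ε) atTop (𝓝 0) := by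
              have := ((tendsto_const_nhds (x := z.2.1 a b)).sub (hz hzs)).div_const ε
              simpa using this
            have h3 := (Real.continuous_cos.tendsto 0).comp h2
            rwa [Real.cos_zero] at h3
          simpa using (h1.const_mul (ψ z.1)).mul_const (∑ i, z.2.1 l i * A i a b z - A l a b z)
        · simp [image_eq_zero_of_notMem_tsupport hzs]
    exact le_of_tendsto hcont.abs (Eventually.of_forall hstep)
  have hzero : Tendsto (fun ε : ℝ => ε * c) (𝓝[>] 0) (𝓝 0) := by
    have : Tendsto (fun ε : ℝ => ε * c) (𝓝 0) (𝓝 (0 * c)) := tendsto_id.mul_const c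
    rw [zero_mul] at this
    exact this.mono_left nhdsWithin_le_nhds
  exact abs_nonpos_iff.mp (ge_of_tendsto hzero (eventually_mem_nhdsWithin.mono hbound))

/-- The mean curvature of a curvature varifold is orthogonal to the tangent planes. -/
theorem IsCurvatureVarifold.ae_perp (hT : AEMeasurable T (weight V))
    (hV : V = (weight V).map (fun x => (x, T x))) (h : IsCurvatureVarifold V A bd) :
    ∀ᵐ z ∂V, ∀ l, ∑ i, z.2.1 l i * meanCurvature A z i = 0 := by
  have h2 : ∀ᵐ z ∂V, ∀ i a b,
      A i a b z = ∑ r, (A i a r z * z.2.1 r b + z.2.1 a r * A i r b z) := by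
    simp only [ae_all_iff]; exact fun i a b => h.ae_leibniz hT hV i a b
  have h3 : ∀ᵐ z ∂V, ∀ l a b, ∑ i, z.2.1 l i * A i a b z - A l a b z = 0 := by
    simp only [ae_all_iff]; exact fun l a b => h.ae_first_index hT hV l a b
  filter_upwards [h2, h3] with z h2 h3 l
  have key : ∀ m, ∑ j, (∑ i, z.2.1 l i * A m i j z) * z.2.1 j m = 0 := by
    intro m
    let P : Matrix (Fin 3) (Fin 3) ℝ := Matrix.of z.2.1
    let B : Matrix (Fin 3) (Fin 3) ℝ := Matrix.of fun a b => A m a b z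
    have hP : P * P = P := by
      ext a b
      rw [Matrix.mul_apply]
      exact z.2.2.2.1 a b
    have hB : B = B * P + P * B := by
      ext a b
      rw [Matrix.add_apply, Matrix.mul_apply, Matrix.mul_apply, ← Finset.sum_add_distrib]
      exact h2 m a b
    have h0 : P * B * P = 0 := by
      have : P * B * P = P * B * P + P * B * P := by
        calc P * B * P = P * (B * P + P * B) * P := by rw [← hB]
          _ = P * B * (P * P) + (P * P) * B * P := by noncomm_ring
          _ = _ := by rw [hP]
      simpa using this
    have := congrFun (congrFun h0 l) m
    rw [Matrix.mul_apply] at this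
    simp only [Matrix.mul_apply] at this
    exact this
  -- Tangentiality of the first index turns P_{li} A_{jij} into the sum over m of (P A_m P)_{lm},
  -- and `key` says that each summand is zero.
  have e : ∀ j i, A j i j z = ∑ m, z.2.1 j m * A m i j z := fun j i =>
    (sub_eq_zero.mp (h3 j i j)).symm
  have : ∑ i, z.2.1 l i * ∑ j, A j i j z = ∑ m, ∑ j, (∑ i, z.2.1 l i * A m i j z) * z.2.1 j m := by
    simp_rw [e]
    simp only [Fin.sum_univ_three]
    ring
  simp only [meanCurvature, mul_div_assoc', ← Finset.sum_div]
  rw [this]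
  simp [key]

end FirstIndex

/-! ### Projection onto a plane -/

/-- The orthogonal projection of `y` onto the plane `P`. -/
noncomputable def tang (P : G23) (y : E3) : E3 := WithLp.toLp 2 fun i => ∑ j, P.1 i j * y j

@[simp] theorem tang_apply (P : G23) (y : E3) (i : Fin 3) : tang P y i = ∑ j, P.1 i j * y j := rfl

theorem inner_eq_sum (x y : E3) : inner ℝ x y = ∑ i, x i * y i := by
  rw [PiLp.inner_apply]
  exact Finset.sum_congr rfl fun i _ => by simp [mul_comm]

theorem inner_tang_comm (P : G23) (x y : E3) : inner ℝ x (tang P y) = inner ℝ (tang P x) y := by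
  simp only [inner_eq_sum, tang_apply, Finset.mul_sum, Finset.sum_mul]
  rw [Finset.sum_comm]
  refine Finset.sum_congr rfl fun i _ => Finset.sum_congr rfl fun j _ => ?_
  rw [P.2.1 j i]
  ring

theorem tang_tang (P : G23) (y : E3) : tang P (tang P y) = tang P y := by
  ext i
  simp only [tang_apply, Finset.mul_sum]
  rw [Finset.sum_comm]
  refine Finset.sum_congr rfl fun j _ => ?_
  rw [← P.2.2.1 i j, Finset.sum_mul]
  exact Finset.sum_congr rfl fun k _ => by ring

theorem inner_tang_self (P : G23) (y : E3) : inner ℝ y (tang P y) = ‖tang P y‖ ^ 2 := by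
  rw [← tang_tang, inner_tang_comm, real_inner_self_eq_norm_sq, tang_tang]

theorem norm_sub_tang_sq (P : G23) (y : E3) :
    ‖y - tang P y‖ ^ 2 = ‖y‖ ^ 2 - ‖tang P y‖ ^ 2 := by
  rw [norm_sub_sq_real, inner_tang_self]
  ring

theorem norm_tang_sq_le (P : G23) (y : E3) : ‖tang P y‖ ^ 2 ≤ ‖y‖ ^ 2 := by
  have := norm_sub_tang_sq P y
  nlinarith [sq_nonneg ‖y - tang P y‖]

theorem continuous_tang (p : E3) : Continuous fun z : GBundle => tang z.2 (z.1 - p) := by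
  refine (PiLp.continuous_toLp 2 _).comp (continuous_pi fun i => ?_)
  refine continuous_finsetSum _ fun j _ => (continuous_entry i j).mul ?_
  exact (EuclideanSpace.proj (𝕜 := ℝ) j).continuous.comp (continuous_fst.sub continuous_const)

/-! ### First variation against radial vector fields -/

theorem hasDerivAt_tail {g : ℝ → ℝ} (hg : Continuous g) (b t : ℝ) :
    HasDerivAt (fun t => ∫ u in t..b, g u) (-g t) t := by
  have := (hg.integral_hasStrictDerivAt b t).hasDerivAt.neg
  refine this.congr_of_eventuallyEq (Eventually.of_forall fun s => ?_)
  exact intervalIntegral.integral_symm b s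

/-- The radial weight is parametrised as a tail integral so that any continuous g gives an
admissible C¹ field, and the discontinuous g of interest needs only approximation by continuous
ones. -/
theorem contDiff_tail {g : ℝ → ℝ} (hg : Continuous g) (b : ℝ) :
    ContDiff ℝ 1 (fun t => ∫ u in t..b, g u) := by
  rw [contDiff_one_iff_deriv]
  refine ⟨fun t => (hasDerivAt_tail hg b t).differentiableAt, ?_⟩
  rw [show deriv (fun t => ∫ u in t..b, g u) = fun t => -g t from
    funext fun t => (hasDerivAt_tail hg b t).deriv]
  exact hg.neg

theorem tail_eq_zero {g : ℝ → ℝ} {b t : ℝ} (h : ∀ u, b ≤ u → g u = 0) (ht : b ≤ t) :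
    ∫ u in t..b, g u = 0 := by
  rw [intervalIntegral.integral_symm, neg_eq_zero]
  refine intervalIntegral.integral_zero_ae (Eventually.of_forall fun u hu => ?_)
  rw [uIoc_of_le ht] at hu
  exact h u hu.1.le

section Radial

variable {V : Measure GBundle} {H : GBundle → E3} {σ : RadonVectorMeasure E3}

/-- The first variation identity tested with a radial vector field. -/
theorem IsGeneralizedBoundary.radial_identity (hb : IsGeneralizedBoundary V H σ) (p : E3)
    {g : ℝ → ℝ} (hg : Continuous g) {b : ℝ} (hgb : ∀ u, b ≤ u → g u = 0) :
    ∫ z, (2 * (∫ u in (‖z.1 - p‖ ^ 2)..b, g u) -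
        2 * g (‖z.1 - p‖ ^ 2) * ‖tang z.2 (z.1 - p)‖ ^ 2) ∂V =
      -2 * ∫ z, (∫ u in (‖z.1 - p‖ ^ 2)..b, g u) * inner ℝ (H z) (z.1 - p) ∂V +
        ∫ x, (∫ u in (‖x - p‖ ^ 2)..b, g u) * inner ℝ (x - p) (σ.dir x) ∂σ.tv := by
  set X : E3 → E3 := fun x => (∫ u in (‖x - p‖ ^ 2)..b, g u) • (x - p) with hX
  have hsub : ContDiff ℝ 1 fun x : E3 => x - p := contDiff_id.sub contDiff_const
  have hXc : ContDiff ℝ 1 X := ((contDiff_tail hg b).comp (hsub.norm_sq ℝ)).smul hsub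
  have hXs : HasCompactSupport X := by
    refine HasCompactSupport.intro (isCompact_closedBall p (Real.sqrt b)) fun x hx => ?_
    rw [mem_closedBall_iff_norm, not_le] at hx
    rw [hX]
    dsimp only
    rw [tail_eq_zero hgb (Real.lt_sq_of_sqrt_lt hx).le, zero_smul]
  have hd : ∀ x v, fderiv ℝ X x v = (∫ u in (‖x - p‖ ^ 2)..b, g u) • v +
      (-g (‖x - p‖ ^ 2) * (2 * inner ℝ (x - p) v)) • (x - p) := by
    intro x v
    have h1 : HasFDerivAt (fun x : E3 => x - p) (ContinuousLinearMap.id ℝ E3) x :=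
      (hasFDerivAt_id x).sub_const p
    have h2 := (hasDerivAt_tail hg b (‖x - p‖ ^ 2)).comp_hasFDerivAt x h1.norm_sq
    have h3 := (h2.smul h1).fderiv
    have h4 : fderiv ℝ X x = _ := h3
    rw [h4]
    simp [inner_sub_left]
  have key := hb.2.2 X hXc hXs
  have e1 : ∀ z : GBundle, ∑ i, ∑ j, z.2.1 i j * fderiv ℝ X z.1 (EuclideanSpace.single j 1) i =
      2 * (∫ u in (‖z.1 - p‖ ^ 2)..b, g u) -
        2 * g (‖z.1 - p‖ ^ 2) * ‖tang z.2 (z.1 - p)‖ ^ 2 := by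
    intro z
    have htr := z.2.2.2.2
    rw [← inner_tang_self, inner_eq_sum]
    have h5 : ∀ j, inner ℝ (z.1 - p) (EuclideanSpace.single j (1 : ℝ)) = (z.1 - p) j := fun j => by
      simp [EuclideanSpace.inner_single_right]
    simp only [hd, h5, tang_apply, PiLp.add_apply, PiLp.smul_apply, smul_eq_mul]
    generalize (∫ u in (‖z.1 - p‖ ^ 2)..b, g u) = a
    generalize g (‖z.1 - p‖ ^ 2) = c
    generalize z.1 - p = y
    simp only [mul_add, Finset.sum_add_distrib]
    have h6 : ∑ i, ∑ j, z.2.1 i j * (a * EuclideanSpace.single j (1 : ℝ) i) = 2 * a := by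
      have : ∀ i j, z.2.1 i j * (a * EuclideanSpace.single j (1 : ℝ) i) =
          if i = j then z.2.1 i j * a else 0 := by
        intro i j
        by_cases hij : i = j <;> simp [hij]
      simp only [this, Finset.sum_ite_eq, Finset.mem_univ, if_true]
      rw [← Finset.sum_mul, htr]
    rw [h6]
    simp only [Fin.sum_univ_three]
    ring
  simp only [e1] at key
  rw [key]
  simp only [hX, real_inner_smul_left, real_inner_smul_right]

end Radial

/-! ### Cut-offs approximating the truncated weight -/

/-- The continuous cut-offs `g_n` approximating `t⁻² 1_{[a,b)}(t)`. -/
noncomputable def cutoff (a b : ℝ) (n : ℕ) (t : ℝ) : ℝ :=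
  ((max t (a / 2)) ^ 2)⁻¹ * (max 0 (min 1 (n * (t - a) + 1)) * max 0 (min 1 (n * (b - t))))

theorem continuous_cutoff {a : ℝ} (ha : 0 < a) (b : ℝ) (n : ℕ) : Continuous (cutoff a b n) := by
  refine Continuous.mul (Continuous.inv₀ (by fun_prop) fun t => ?_) (by fun_prop)
  have : 0 < max t (a / 2) := lt_max_of_lt_right (by positivity)
  positivity

theorem cutoff_eq_zero {a b t : ℝ} (n : ℕ) (h : b ≤ t) : cutoff a b n t = 0 := by
  have : min 1 ((n : ℝ) * (b - t)) ≤ 0 :=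
    min_le_of_right_le (mul_nonpos_of_nonneg_of_nonpos n.cast_nonneg (by linarith))
  rw [cutoff, max_eq_left this, mul_zero, mul_zero]

theorem cutoff_nonneg (a b t : ℝ) (n : ℕ) : 0 ≤ cutoff a b n t := by
  unfold cutoff; positivity

theorem cutoff_le {a : ℝ} (ha : 0 < a) (b t : ℝ) (n : ℕ) : cutoff a b n t ≤ ((a / 2) ^ 2)⁻¹ := by
  have h1 : ((max t (a / 2)) ^ 2)⁻¹ ≤ ((a / 2) ^ 2)⁻¹ := by
    gcongr
    exact le_max_right _ _
  have h2 : ∀ x : ℝ, max 0 (min 1 x) ≤ 1 := fun x => max_le zero_le_one (min_le_left _ _)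
  unfold cutoff
  calc _ ≤ ((a / 2) ^ 2)⁻¹ * (1 * 1) := by
        gcongr <;> exact h2 _
    _ = _ := by ring

/-- The left ramp already equals 1 at a and the right ramp vanishes at b, so the limit is the
half-open interval, matching the complement of one open ball inside another. The lower bound a/2
inside the square keeps the weight bounded uniformly in n. -/
theorem tendsto_cutoff {a : ℝ} (ha : 0 < a) (b t : ℝ) :
    Tendsto (fun n => cutoff a b n t) atTop
      (𝓝 ((Ico a b).indicator (fun t => (t ^ 2)⁻¹) t)) := by
  rcases lt_or_ge t a with h | h
  · rw [indicator_of_notMem (fun h' => h.not_ge h'.1)]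
    have hev : ∀ᶠ n : ℕ in atTop, 1 / (a - t) ≤ n := by
      obtain ⟨N, hN⟩ := exists_nat_ge (1 / (a - t))
      filter_upwards [eventually_ge_atTop N] with n hn
      exact hN.trans (by exact_mod_cast hn)
    refine tendsto_const_nhds.congr' ?_
    filter_upwards [hev] with n hn
    rw [div_le_iff₀ (by linarith)] at hn
    have : min 1 ((n : ℝ) * (t - a) + 1) ≤ 0 := min_le_of_right_le (by nlinarith)
    rw [cutoff, max_eq_left this, zero_mul, mul_zero]
  rcases lt_or_ge t b with h' | h'
  · rw [indicator_of_mem (show t ∈ Ico a b from ⟨h, h'⟩)]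
    have hev : ∀ᶠ n : ℕ in atTop, 1 / (b - t) ≤ n := by
      obtain ⟨N, hN⟩ := exists_nat_ge (1 / (b - t))
      filter_upwards [eventually_ge_atTop N] with n hn
      exact hN.trans (by exact_mod_cast hn)
    refine tendsto_const_nhds.congr' ?_
    filter_upwards [hev] with n hn
    rw [div_le_iff₀ (by linarith)] at hn
    have h1 : (1 : ℝ) ≤ n * (t - a) + 1 := by
      have : (0 : ℝ) ≤ n * (t - a) := mul_nonneg n.cast_nonneg (by linarith)
      linarith
    rw [cutoff, min_eq_left h1, min_eq_left hn, max_eq_left (by linarith : a / 2 ≤ t)]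
    simp
  · rw [indicator_of_notMem (fun h'' => h'.not_gt h''.2)]
    exact tendsto_const_nhds.congr fun n => (cutoff_eq_zero n h').symm

/-- The primitive of `t⁻² 1_{[a,b)}(t)` vanishing at `b`. -/
noncomputable def profile (a b t : ℝ) : ℝ := (min (max t a) b)⁻¹ - b⁻¹

theorem tail_indicator {a b : ℝ} (ha : 0 < a) (hab : a < b) (t : ℝ) :
    ∫ u in t..b, (Ico a b).indicator (fun t => (t ^ 2)⁻¹) u = profile a b t := by
  have hint : ∀ s, a ≤ s → s ≤ b →
      ∫ u in s..b, (Ico a b).indicator (fun t => (t ^ 2)⁻¹) u = s⁻¹ - b⁻¹ := by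
    intro s hs hsb
    have h1 : ∫ u in s..b, (Ico a b).indicator (fun t => (t ^ 2)⁻¹) u = ∫ u in s..b, (u ^ 2)⁻¹ := by
      refine intervalIntegral.integral_congr_ae ?_
      have : ∀ᵐ u : ℝ, u ≠ b := by simp [ae_iff]
      filter_upwards [this] with u hu hmem
      rw [uIoc_of_le hsb] at hmem
      exact indicator_of_mem
        (show u ∈ Ico a b from ⟨hs.trans hmem.1.le, lt_of_le_of_ne hmem.2 hu⟩) _
    rw [h1]
    have hderiv : ∀ u ∈ uIcc s b, HasDerivAt (fun u : ℝ => -u⁻¹) ((u ^ 2)⁻¹) u := by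
      intro u hu
      rw [uIcc_of_le hsb] at hu
      have := (hasDerivAt_inv (show u ≠ 0 by linarith [hu.1])).fun_neg
      rwa [neg_neg] at this
    rw [intervalIntegral.integral_eq_sub_of_hasDerivAt hderiv]
    · ring
    · refine ContinuousOn.intervalIntegrable fun u hu => ContinuousAt.continuousWithinAt ?_
      rw [uIcc_of_le hsb] at hu
      have : u ^ 2 ≠ 0 := by have : 0 < u := by linarith [hu.1]
                             positivity
      fun_prop (disch := assumption)
  unfold profile
  rcases le_or_gt b t with h | h
  · rw [tail_eq_zero (fun u hu => indicator_of_notMem (fun h' => hu.not_gt h'.2) _) h,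
      min_eq_right (h.trans (le_max_left _ _)), sub_self]
  rcases le_or_gt a t with h' | h'
  · rw [max_eq_left h', min_eq_left h.le, hint t h' h.le]
  · rw [max_eq_right h'.le, min_eq_left hab.le, ← hint a le_rfl hab.le]
    have hi : ∀ x y, IntervalIntegrable
        ((Ico a b).indicator (fun t : ℝ => (t ^ 2)⁻¹)) volume x y := by
      intro x y
      refine IntegrableOn.intervalIntegrable ?_
      refine Integrable.integrableOn ?_
      rw [integrable_indicator_iff measurableSet_Ico]
      refine IntegrableOn.mono_set (t := Icc a b) ?_ Ico_subset_Icc_self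
      refine ContinuousOn.integrableOn_Icc fun u hu => ContinuousAt.continuousWithinAt ?_
      have : u ^ 2 ≠ 0 := by have : 0 < u := by linarith [hu.1]
                             positivity
      fun_prop (disch := assumption)
    rw [← intervalIntegral.integral_add_adjacent_intervals (hi t a) (hi a b)]
    rw [add_eq_right]
    refine intervalIntegral.integral_zero_ae ?_
    have : ∀ᵐ u : ℝ, u ≠ a := by simp [ae_iff]
    filter_upwards [this] with u hu hmem
    rw [uIoc_of_le h'.le] at hmem
    exact indicator_of_notMem (fun h'' => hu (le_antisymm hmem.2 h''.1)) _

theorem tendsto_tail_cutoff {a b : ℝ} (ha : 0 < a) (hab : a < b) (t : ℝ) :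
    Tendsto (fun n => ∫ u in t..b, cutoff a b n u) atTop (𝓝 (profile a b t)) := by
  rw [← tail_indicator ha hab]
  refine intervalIntegral.tendsto_integral_filter_of_dominated_convergence
    (fun _ => ((a / 2) ^ 2)⁻¹) (Eventually.of_forall fun n =>
      (continuous_cutoff ha b n).aestronglyMeasurable) (Eventually.of_forall fun n =>
      Eventually.of_forall fun u _ => ?_) (by simp)
    (Eventually.of_forall fun u _ => tendsto_cutoff ha b u)
  rw [Real.norm_of_nonneg (cutoff_nonneg a b u n)]
  exact cutoff_le ha b u n

theorem abs_tail_cutoff_le {a b t : ℝ} (ha : 0 < a) (ht : 0 ≤ t) (n : ℕ) :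
    |∫ u in t..b, cutoff a b n u| ≤ if t ≤ b then ((a / 2) ^ 2)⁻¹ * b else 0 := by
  split_ifs with h
  · have := intervalIntegral.norm_integral_le_of_norm_le_const (a := t) (b := b)
      (f := cutoff a b n) (C := ((a / 2) ^ 2)⁻¹) (fun u _ => by
        rw [Real.norm_of_nonneg (cutoff_nonneg a b u n)]
        exact cutoff_le ha b u n)
    rw [Real.norm_eq_abs, abs_of_nonneg (sub_nonneg.mpr h)] at this
    refine this.trans ?_
    gcongr
    linarith
  · rw [tail_eq_zero (fun u hu => cutoff_eq_zero n hu) (not_le.mp h).le, abs_zero]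

theorem isCompact_closedCylinder (p : E3) (b : ℝ) :
    IsCompact {z : GBundle | ‖z.1 - p‖ ^ 2 ≤ b} := by
  refine (isCompact_cylinder (isCompact_closedBall p (Real.sqrt b))).of_isClosed_subset
    (isClosed_le (by fun_prop) continuous_const) fun z hz => ?_
  exact mem_closedBall_iff_norm.mpr (Real.le_sqrt_of_sq_le hz)

theorem profile_nonneg {a b : ℝ} (ha : 0 < a) (hab : a < b) (t : ℝ) : 0 ≤ profile a b t := by
  have h : 0 < min (max t a) b := lt_min (lt_max_of_lt_right ha) (ha.trans hab)
  exact sub_nonneg.mpr (inv_anti₀ h (min_le_right _ _))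

theorem profile_eq_zero {a b t : ℝ} (h : b ≤ t) : profile a b t = 0 := by
  rw [profile, min_eq_right (h.trans (le_max_left _ _)), sub_self]

theorem profile_le {a b : ℝ} (ha : 0 < a) (hab : a < b) (t : ℝ) : profile a b t ≤ a⁻¹ := by
  have h : a⁻¹ ≥ (min (max t a) b)⁻¹ := inv_anti₀ ha (le_min (le_max_right _ _) hab.le)
  have : 0 < b⁻¹ := inv_pos.mpr (ha.trans hab)
  unfold profile
  linarith

/-- Unlike the bound by a⁻¹, this one does not involve the inner radius, so it controls the boundary
term uniformly over all radii. -/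
theorem profile_le_inv {a b t : ℝ} (ha : 0 < a) (hab : a < b) (ht : 0 < t) :
    profile a b t ≤ t⁻¹ := by
  rcases le_or_gt b t with h | h
  · rw [profile_eq_zero h]; positivity
  · have h1 : t⁻¹ ≥ (min (max t a) b)⁻¹ := inv_anti₀ ht (le_min (le_max_left _ _) h.le)
    have : 0 < b⁻¹ := inv_pos.mpr (ha.trans hab)
    unfold profile
    linarith

theorem continuous_profile {a b : ℝ} (ha : 0 < a) (hab : a < b) : Continuous (profile a b) := by
  refine (Continuous.inv₀ (by fun_prop) fun t => ?_).sub continuous_const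
  have h : 0 < min (max t a) b := lt_min (lt_max_of_lt_right ha) (ha.trans hab)
  exact h.ne'

/-! ### The monotonicity formula -/

section Monotonicity

variable {V : Measure GBundle} [IsLocallyFiniteMeasure V] {H : GBundle → E3}
  {σ : RadonVectorMeasure E3}

/-- The weight of the radial vector field against the tangential part of the position. -/
theorem indicator_mul_tang_le {b : ℝ} {g : ℝ → ℝ} {c : ℝ} (h0 : ∀ t, 0 ≤ g t)
    (hc : ∀ t, g t ≤ c) (hgb : ∀ t, b ≤ t → g t = 0) (p : E3) (z : GBundle) :
    |g (‖z.1 - p‖ ^ 2) * ‖tang z.2 (z.1 - p)‖ ^ 2| ≤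
      {z : GBundle | ‖z.1 - p‖ ^ 2 ≤ b}.indicator (fun _ => c * b) z := by
  have h1 := norm_tang_sq_le z.2 (z.1 - p)
  have hc0 : 0 ≤ c := (h0 0).trans (hc 0)
  rw [abs_of_nonneg (mul_nonneg (h0 _) (sq_nonneg _))]
  by_cases h : ‖z.1 - p‖ ^ 2 ≤ b
  · rw [indicator_of_mem (show z ∈ {z : GBundle | ‖z.1 - p‖ ^ 2 ≤ b} from h)]
    exact mul_le_mul (hc _) (h1.trans h) (sq_nonneg _) hc0
  · rw [indicator_of_notMem (show z ∉ {z : GBundle | ‖z.1 - p‖ ^ 2 ≤ b} from h),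
      hgb _ (not_le.mp h).le, zero_mul]

theorem integrable_indicator_const (p : E3) (b c : ℝ) :
    Integrable ({z : GBundle | ‖z.1 - p‖ ^ 2 ≤ b}.indicator (fun _ => c)) V := by
  rw [integrable_indicator_iff (isCompact_closedCylinder p b).isClosed.measurableSet]
  exact integrableOn_const (isCompact_closedCylinder p b).measure_lt_top.ne

omit [IsLocallyFiniteMeasure V] in
theorem integrable_indicator_norm (hH : LocallyIntegrable H V) (p : E3) (b c : ℝ) :
    Integrable ({z : GBundle | ‖z.1 - p‖ ^ 2 ≤ b}.indicator (fun z => c * ‖H z‖)) V := by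
  rw [integrable_indicator_iff (isCompact_closedCylinder p b).isClosed.measurableSet]
  exact (hH.integrableOn_isCompact (isCompact_closedCylinder p b)).norm.const_mul c

theorem abs_weight_mul_inner_le {b c w : ℝ} (p x v : E3) (hw : |w| ≤ c)
    (hwb : b ≤ ‖x - p‖ ^ 2 → w = 0) :
    |w * inner ℝ v (x - p)| ≤ if ‖x - p‖ ^ 2 ≤ b then c * Real.sqrt b * ‖v‖ else 0 := by
  have hc : 0 ≤ c := (abs_nonneg w).trans hw
  split_ifs with h
  · rw [abs_mul, mul_assoc]
    refine mul_le_mul hw ((abs_real_inner_le_norm _ _).trans ?_) (abs_nonneg _) hc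
    rw [mul_comm]
    exact mul_le_mul_of_nonneg_right (Real.le_sqrt_of_sq_le h) (norm_nonneg _)
  · rw [hwb (not_le.mp h).le, zero_mul, abs_zero]

/-- Dominated convergence in the radial identity for the cut-offs: all integrands live over the
compact ball |x - p|² ≤ b, with bounds uniform in n. -/
theorem IsGeneralizedBoundary.profile_identity (hb : IsGeneralizedBoundary V H σ) (p : E3)
    {a b : ℝ} (ha : 0 < a) (hab : a < b) :
    ∫ z, (profile a b (‖z.1 - p‖ ^ 2) - (Ico a b).indicator (fun t => (t ^ 2)⁻¹) (‖z.1 - p‖ ^ 2) *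
        ‖tang z.2 (z.1 - p)‖ ^ 2) ∂V =
      -∫ z, profile a b (‖z.1 - p‖ ^ 2) * inner ℝ (H z) (z.1 - p) ∂V +
        1 / 2 * ∫ x, profile a b (‖x - p‖ ^ 2) * inner ℝ (x - p) (σ.dir x) ∂σ.tv := by
  have hb0 : 0 < b := ha.trans hab
  have hσ := σ.locallyFinite
  set c : ℝ := ((a / 2) ^ 2)⁻¹ with hc
  have hc0 : 0 < c := by positivity
  have hnorm : Continuous fun z : GBundle => ‖z.1 - p‖ ^ 2 := by fun_prop
  have hnorm' : Continuous fun x : E3 => ‖x - p‖ ^ 2 := by fun_prop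
  have htail : ∀ n, Continuous fun t => ∫ u in t..b, cutoff a b n u := fun n =>
    (contDiff_tail (continuous_cutoff ha b n) b).continuous
  have htb : ∀ (n : ℕ) (t : ℝ), 0 ≤ t → |∫ u in t..b, cutoff a b n u| ≤ c * b := by
    intro n t ht
    refine (abs_tail_cutoff_le ha ht n).trans ?_
    split_ifs
    · exact le_rfl
    · positivity
  have htz : ∀ (n : ℕ) (t : ℝ), b ≤ t → ∫ u in t..b, cutoff a b n u = 0 := fun n t ht =>
    tail_eq_zero (fun u hu => cutoff_eq_zero n hu) ht
  have L1 : Tendsto (fun n => ∫ z, (2 * (∫ u in (‖z.1 - p‖ ^ 2)..b, cutoff a b n u) -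
      2 * cutoff a b n (‖z.1 - p‖ ^ 2) * ‖tang z.2 (z.1 - p)‖ ^ 2) ∂V) atTop
      (𝓝 (∫ z, (2 * profile a b (‖z.1 - p‖ ^ 2) -
        2 * (Ico a b).indicator (fun t => (t ^ 2)⁻¹) (‖z.1 - p‖ ^ 2) *
          ‖tang z.2 (z.1 - p)‖ ^ 2) ∂V)) := by
    refine tendsto_integral_of_dominated_convergence
      ({z : GBundle | ‖z.1 - p‖ ^ 2 ≤ b}.indicator (fun _ => 2 * (c * b) + 2 * (c * b)))
      (fun n => ?_) (integrable_indicator_const p b _)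
      (fun n => Eventually.of_forall fun z => ?_) (Eventually.of_forall fun z => ?_)
    · refine Continuous.aestronglyMeasurable ?_
      exact (continuous_const.mul ((htail n).comp hnorm)).sub
        ((continuous_const.mul ((continuous_cutoff ha b n).comp hnorm)).mul
          ((continuous_tang p).norm.pow 2))
    · have h1 := indicator_mul_tang_le (cutoff_nonneg a b · n)
        (fun t => cutoff_le ha b t n) (fun t ht => cutoff_eq_zero n ht) p z
      have h2 := abs_tail_cutoff_le (b := b) ha (sq_nonneg ‖z.1 - p‖) n
      rw [Real.norm_eq_abs, mul_assoc 2 (cutoff _ _ _ _)]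
      refine (abs_sub _ _).trans ?_
      rw [abs_mul, abs_mul, abs_two]
      by_cases h : ‖z.1 - p‖ ^ 2 ≤ b
      · rw [if_pos h] at h2
        rw [indicator_of_mem (show z ∈ {z : GBundle | ‖z.1 - p‖ ^ 2 ≤ b} from h)] at h1 ⊢
        linarith
      · rw [if_neg h] at h2
        rw [indicator_of_notMem (show z ∉ {z : GBundle | ‖z.1 - p‖ ^ 2 ≤ b} from h)] at h1 ⊢
        linarith
    · exact ((tendsto_tail_cutoff ha hab _).const_mul 2).sub
        (((tendsto_cutoff ha b _).const_mul 2).mul_const _)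
  have L2 : Tendsto (fun n => ∫ z, (∫ u in (‖z.1 - p‖ ^ 2)..b, cutoff a b n u) *
      inner ℝ (H z) (z.1 - p) ∂V) atTop
      (𝓝 (∫ z, profile a b (‖z.1 - p‖ ^ 2) * inner ℝ (H z) (z.1 - p) ∂V)) := by
    refine tendsto_integral_of_dominated_convergence
      ({z : GBundle | ‖z.1 - p‖ ^ 2 ≤ b}.indicator (fun z => c * b * Real.sqrt b * ‖H z‖))
      (fun n => ?_) (integrable_indicator_norm hb.1 p b _)
      (fun n => Eventually.of_forall fun z => ?_) (Eventually.of_forall fun z => ?_)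
    · refine ((htail n).comp hnorm).aestronglyMeasurable.mul ?_
      exact hb.1.aestronglyMeasurable.inner
        (continuous_fst.sub continuous_const).aestronglyMeasurable
    · have := abs_weight_mul_inner_le p z.1 (H z) (htb n _ (sq_nonneg _)) (htz n _)
      simpa [indicator] using this
    · exact (tendsto_tail_cutoff ha hab _).mul_const _
  have L3 : Tendsto (fun n => ∫ x, (∫ u in (‖x - p‖ ^ 2)..b, cutoff a b n u) *
      inner ℝ (x - p) (σ.dir x) ∂σ.tv) atTop
      (𝓝 (∫ x, profile a b (‖x - p‖ ^ 2) * inner ℝ (x - p) (σ.dir x) ∂σ.tv)) := by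
    refine tendsto_integral_of_dominated_convergence
      ((Metric.closedBall p (Real.sqrt b)).indicator (fun _ => c * b * Real.sqrt b))
      (fun n => ?_) ?_ (fun n => ?_) (Eventually.of_forall fun x => ?_)
    · refine ((htail n).comp hnorm').aestronglyMeasurable.mul ?_
      exact (continuous_id.sub continuous_const).aestronglyMeasurable.inner
        σ.measurable_dir.aestronglyMeasurable
    · rw [integrable_indicator_iff measurableSet_closedBall]
      exact integrableOn_const measure_closedBall_lt_top.ne
    · filter_upwards [σ.norm_dir] with x hx
      have := abs_weight_mul_inner_le p x (σ.dir x) (htb n _ (sq_nonneg _)) (htz n _)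
      rw [real_inner_comm, hx, mul_one] at this
      rw [Real.norm_eq_abs]
      refine this.trans_eq ?_
      have hiff : ‖x - p‖ ^ 2 ≤ b ↔ x ∈ Metric.closedBall p (Real.sqrt b) := by
        rw [mem_closedBall_iff_norm]
        exact (Real.le_sqrt (norm_nonneg _) hb0.le).symm
      simp [indicator, hiff]
    · exact (tendsto_tail_cutoff ha hab _).mul_const _
  have hid := fun n => hb.radial_identity p (continuous_cutoff ha b n)
    (fun u hu => cutoff_eq_zero n hu)
  have hlim := tendsto_nhds_unique (L1.congr hid) ((L2.const_mul (-2)).add L3)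
  have hre : ∫ z, (2 * profile a b (‖z.1 - p‖ ^ 2) -
        2 * (Ico a b).indicator (fun t => (t ^ 2)⁻¹) (‖z.1 - p‖ ^ 2) *
          ‖tang z.2 (z.1 - p)‖ ^ 2) ∂V = 2 * ∫ z, (profile a b (‖z.1 - p‖ ^ 2) -
        (Ico a b).indicator (fun t => (t ^ 2)⁻¹) (‖z.1 - p‖ ^ 2) *
        ‖tang z.2 (z.1 - p)‖ ^ 2) ∂V := by
    rw [← integral_const_mul]
    exact integral_congr_ae (Eventually.of_forall fun z => by ring)
  rw [hre] at hlim
  linarith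

/-- The open cylinder over the ball `B_ρ(p)`. -/
def cyl (p : E3) (ρ : ℝ) : Set GBundle := {z | z.1 ∈ Metric.ball p ρ}

theorem measurableSet_cyl (p : E3) (ρ : ℝ) : MeasurableSet (cyl p ρ) :=
  measurable_fst measurableSet_ball

theorem cyl_mono {p q : E3} {ρ r : ℝ} (h : ρ + dist p q ≤ r) : cyl p ρ ⊆ cyl q r :=
  fun _ hz => Metric.ball_subset_ball' h hz

theorem cyl_subset_closed (p : E3) (ρ : ℝ) : cyl p ρ ⊆ {z : GBundle | ‖z.1 - p‖ ^ 2 ≤ ρ ^ 2} := by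
  intro z hz
  have : ‖z.1 - p‖ < ρ := mem_ball_iff_norm.mp hz
  exact pow_le_pow_left₀ (norm_nonneg _) this.le 2

theorem measure_cyl_lt_top (p : E3) (ρ : ℝ) : V (cyl p ρ) < ⊤ :=
  (measure_mono (cyl_subset_closed p ρ)).trans_lt (isCompact_closedCylinder p _).measure_lt_top

/-- The integrand of the monotone quantity. -/
noncomputable def monoIntegrand (H : GBundle → E3) (p : E3) (ρ : ℝ) (z : GBundle) : ℝ :=
  (ρ ^ 2)⁻¹ * (1 + inner ℝ (H z) (z.1 - p)) + ‖H z‖ ^ 2 / 4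

/-- The monotone quantity `ρ⁻² μ(B_ρ) + ρ⁻² ∫_{B_ρ} ⟨H, x - p⟩ + ¼ ∫_{B_ρ} |H|²`. -/
noncomputable def monoQuantity (V : Measure GBundle) (H : GBundle → E3) (p : E3) (ρ : ℝ) : ℝ :=
  ∫ z in cyl p ρ, monoIntegrand H p ρ z ∂V

/-- The mass ratio `ρ⁻² μ(B_ρ)`. -/
noncomputable def massRatio (V : Measure GBundle) (p : E3) (ρ : ℝ) : ℝ :=
  V.real (cyl p ρ) / ρ ^ 2

/-- The Willmore energy in `B_ρ`. -/
noncomputable def energy (V : Measure GBundle) (H : GBundle → E3) (p : E3) (ρ : ℝ) : ℝ :=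
  ∫ z in cyl p ρ, ‖H z‖ ^ 2 ∂V

omit [IsLocallyFiniteMeasure V] in
theorem integrableOn_inner (hH : LocallyIntegrable H V) (p : E3) (ρ : ℝ) :
    IntegrableOn (fun z => inner ℝ (H z) (z.1 - p)) (cyl p ρ) V := by
  have hc := isCompact_closedCylinder p (ρ ^ 2)
  refine IntegrableOn.mono_set ?_ (cyl_subset_closed p ρ)
  refine Integrable.mono' ((hH.integrableOn_isCompact hc).norm.mul_const |ρ|) ?_ ?_
  · exact hH.aestronglyMeasurable.restrict.inner
      (continuous_fst.sub continuous_const).aestronglyMeasurable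
  · filter_upwards [ae_restrict_mem hc.isClosed.measurableSet] with z hz
    refine (abs_real_inner_le_norm _ _).trans (mul_le_mul_of_nonneg_left ?_ (norm_nonneg _))
    exact abs_norm (z.1 - p) ▸ sq_le_sq.mp hz

theorem integrableOn_monoIntegrand (hH : LocallyIntegrable H V)
    (hW : Integrable (fun z => ‖H z‖ ^ 2) V) (p : E3) (ρ : ℝ) :
    IntegrableOn (monoIntegrand H p ρ) (cyl p ρ) V :=
  (((integrableOn_const (measure_cyl_lt_top p ρ).ne).add (integrableOn_inner hH p ρ)).const_mul
    _).add (hW.integrableOn.div_const 4)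

/-- The weighted monotonicity formula, as an inequality. -/
theorem IsGeneralizedBoundary.monotonicity (hb : IsGeneralizedBoundary V H σ)
    (hperp : ∀ᵐ z ∂V, ∀ l, ∑ i, z.2.1 l i * H z i = 0)
    (hW : Integrable (fun z => ‖H z‖ ^ 2) V) (p : E3) {s r : ℝ} (hs : 0 < s) (hsr : s < r) :
    monoQuantity V H p s ≤ monoQuantity V H p r +
      1 / 2 * ∫ x, profile (s ^ 2) (r ^ 2) (‖x - p‖ ^ 2) * inner ℝ (x - p) (σ.dir x) ∂σ.tv := by
  have hr : 0 < r := hs.trans hsr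
  have hs2 : 0 < s ^ 2 := by positivity
  have hr2 : 0 < r ^ 2 := by positivity
  have hsr2 : s ^ 2 < r ^ 2 := pow_lt_pow_left₀ hsr hs.le two_ne_zero
  have hnorm : Continuous fun z : GBundle => ‖z.1 - p‖ ^ 2 := by fun_prop
  have hid := hb.profile_identity p hs2 hsr2
  have hI1 : Integrable (fun z : GBundle => profile (s ^ 2) (r ^ 2) (‖z.1 - p‖ ^ 2)) V := by
    refine (integrable_indicator_const p (r ^ 2) (s ^ 2)⁻¹).mono'
      ((continuous_profile hs2 hsr2).comp hnorm).aestronglyMeasurable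
      (Eventually.of_forall fun z => ?_)
    rw [Real.norm_of_nonneg (profile_nonneg hs2 hsr2 _)]
    by_cases h : ‖z.1 - p‖ ^ 2 ≤ r ^ 2
    · rw [indicator_of_mem (show z ∈ {z : GBundle | ‖z.1 - p‖ ^ 2 ≤ r ^ 2} from h)]
      exact profile_le hs2 hsr2 _
    · rw [indicator_of_notMem (show z ∉ {z : GBundle | ‖z.1 - p‖ ^ 2 ≤ r ^ 2} from h),
        profile_eq_zero (not_le.mp h).le]
  have hI2 : Integrable (fun z : GBundle =>
      (Ico (s ^ 2) (r ^ 2)).indicator (fun t => (t ^ 2)⁻¹) (‖z.1 - p‖ ^ 2) *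
        ‖tang z.2 (z.1 - p)‖ ^ 2) V := by
    refine (integrable_indicator_const p (r ^ 2) (((s ^ 2) ^ 2)⁻¹ * r ^ 2)).mono' ?_
      (Eventually.of_forall fun z => indicator_mul_tang_le
        (fun t => indicator_nonneg (fun u _ => by positivity) t) (fun t => ?_)
        (fun t ht => indicator_of_notMem (fun h => ht.not_gt h.2) _) p z)
    · refine AEStronglyMeasurable.mul ?_ ((continuous_tang p).norm.pow 2).aestronglyMeasurable
      have : Measurable ((Ico (s ^ 2) (r ^ 2)).indicator (fun t : ℝ => (t ^ 2)⁻¹)) :=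
        Measurable.indicator (by fun_prop) measurableSet_Ico
      exact (this.comp hnorm.measurable).aestronglyMeasurable
    · refine indicator_apply_le' (fun h => ?_) (fun _ => by positivity)
      exact inv_anti₀ (by positivity) (pow_le_pow_left₀ hs2.le h.1 2)
  have hI3 : Integrable (fun z : GBundle => profile (s ^ 2) (r ^ 2) (‖z.1 - p‖ ^ 2) *
      inner ℝ (H z) (z.1 - p)) V := by
    refine (integrable_indicator_norm hb.1 p (r ^ 2) ((s ^ 2)⁻¹ * Real.sqrt (r ^ 2))).mono' ?_
      (Eventually.of_forall fun z => ?_)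
    · exact ((continuous_profile hs2 hsr2).comp hnorm).aestronglyMeasurable.mul
        (hb.1.aestronglyMeasurable.inner (continuous_fst.sub continuous_const).aestronglyMeasurable)
    · have := abs_weight_mul_inner_le (b := r ^ 2) p z.1 (H z)
        ((abs_of_nonneg (profile_nonneg hs2 hsr2 (‖z.1 - p‖ ^ 2))).trans_le (profile_le hs2 hsr2 _))
        (fun h => profile_eq_zero h)
      simpa [indicator] using this
  have key : ∫ z, ((cyl p s).indicator (monoIntegrand H p s) z -
      (cyl p r).indicator (monoIntegrand H p r) z) ∂V ≤
      ∫ z, ((profile (s ^ 2) (r ^ 2) (‖z.1 - p‖ ^ 2) -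
        (Ico (s ^ 2) (r ^ 2)).indicator (fun t => (t ^ 2)⁻¹) (‖z.1 - p‖ ^ 2) *
        ‖tang z.2 (z.1 - p)‖ ^ 2) + profile (s ^ 2) (r ^ 2) (‖z.1 - p‖ ^ 2) *
          inner ℝ (H z) (z.1 - p)) ∂V := by
    refine integral_mono_ae
      (((integrable_indicator_iff (measurableSet_cyl p s)).mpr
        (integrableOn_monoIntegrand hb.1 hW p s)).sub
        ((integrable_indicator_iff (measurableSet_cyl p r)).mpr
        (integrableOn_monoIntegrand hb.1 hW p r))) ((hI1.sub hI2).add hI3) ?_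
    filter_upwards [hperp] with z hz
    set y := z.1 - p with hy
    have hmem : ∀ ρ : ℝ, 0 < ρ → (z ∈ cyl p ρ ↔ ‖y‖ ^ 2 < ρ ^ 2) := fun ρ hρ => by
      rw [pow_lt_pow_iff_left₀ (norm_nonneg _) hρ.le two_ne_zero]
      exact mem_ball_iff_norm
    -- On the inner ball the energy terms cancel and equality holds; outside the outer ball
    -- everything vanishes. Inequality arises only on the annulus.
    rcases lt_or_ge (‖y‖ ^ 2) (s ^ 2) with h | h
    · rw [indicator_of_mem ((hmem s hs).mpr h), indicator_of_mem ((hmem r hr).mpr (h.trans hsr2)),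
        indicator_of_notMem (fun h' => h.not_ge h'.1), profile, max_eq_right h.le,
        min_eq_left hsr2.le]
      simp only [monoIntegrand, ← hy]
      refine le_of_eq ?_
      ring
    rcases lt_or_ge (‖y‖ ^ 2) (r ^ 2) with h' | h'
    · rw [indicator_of_notMem (fun h'' => ((hmem s hs).mp h'').not_ge h),
        indicator_of_mem ((hmem r hr).mpr h'),
        indicator_of_mem (show ‖y‖ ^ 2 ∈ Ico (s ^ 2) (r ^ 2) from ⟨h, h'⟩), profile, max_eq_left h,
        min_eq_left h'.le]
      simp only [monoIntegrand, ← hy]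
      have hHt : inner ℝ (H z) (tang z.2 y) = 0 := by
        rw [inner_tang_comm]
        have : tang z.2 (H z) = 0 := by ext l; exact hz l
        rw [this, inner_zero_left]
      -- The gap between the two integrands on the annulus is exactly |y^⊥/|y|² + H/2|²;
      -- orthogonality of H replaces ⟨H, y^⊥⟩ by ⟨H, y⟩.
      have hsq : 0 ≤ ‖(‖y‖ ^ 2)⁻¹ • (y - tang z.2 y) + (1 / 2 : ℝ) • H z‖ ^ 2 := sq_nonneg _
      rw [norm_add_sq_real, norm_smul, norm_smul, mul_pow, mul_pow, norm_sub_tang_sq,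
        real_inner_smul_left, real_inner_smul_right, real_inner_comm, inner_sub_right, hHt,
        Real.norm_eq_abs, Real.norm_eq_abs, sq_abs, sq_abs, sub_zero] at hsq
      have ht : 0 < ‖y‖ ^ 2 := hs2.trans_le h
      have e : ((‖y‖ ^ 2)⁻¹) ^ 2 * ‖y‖ ^ 2 = (‖y‖ ^ 2)⁻¹ := by
        field_simp
      have e' : ((‖y‖ ^ 2) ^ 2)⁻¹ = ((‖y‖ ^ 2)⁻¹) ^ 2 := by rw [inv_pow]
      rw [e']
      nlinarith
    · rw [indicator_of_notMem (fun h'' => ((hmem s hs).mp h'').not_ge h),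
        indicator_of_notMem (fun h'' => ((hmem r hr).mp h'').not_ge h'),
        indicator_of_notMem (fun h'' => h''.2.not_ge h'), profile_eq_zero h']
      simp
  have hadd := integral_add (hI1.sub hI2) hI3
  simp only [Pi.sub_apply] at hadd
  rw [integral_sub ((integrable_indicator_iff (measurableSet_cyl p s)).mpr
        (integrableOn_monoIntegrand hb.1 hW p s))
        ((integrable_indicator_iff (measurableSet_cyl p r)).mpr
        (integrableOn_monoIntegrand hb.1 hW p r)), integral_indicator (measurableSet_cyl p s),
    integral_indicator (measurableSet_cyl p r), hadd, hid] at key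
  unfold monoQuantity
  linarith

end Monotonicity

/-! ### Existence, semicontinuity and bound of the density -/

section Density

variable {V : Measure GBundle} [IsLocallyFiniteMeasure V] {H : GBundle → E3}
  {σ : RadonVectorMeasure E3}

omit [IsLocallyFiniteMeasure V] in
theorem massRatio_nonneg (p : E3) (ρ : ℝ) : 0 ≤ massRatio V p ρ := by
  unfold massRatio; positivity

omit [IsLocallyFiniteMeasure V] in
theorem energy_mono (hW : Integrable (fun z => ‖H z‖ ^ 2) V) {p q : E3} {ρ r : ℝ}
    (h : ρ + dist p q ≤ r) : energy V H p ρ ≤ energy V H q r :=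
  setIntegral_mono_set hW.integrableOn (Eventually.of_forall fun _ => sq_nonneg _)
    (cyl_mono h).eventuallyLE

omit [IsLocallyFiniteMeasure V] in
theorem energy_le_total (hW : Integrable (fun z => ‖H z‖ ^ 2) V) (p : E3) (ρ : ℝ) :
    energy V H p ρ ≤ ∫ z, ‖H z‖ ^ 2 ∂V :=
  setIntegral_le_integral hW (Eventually.of_forall fun _ => sq_nonneg _)

theorem massRatio_le {p q : E3} {ρ r : ℝ} (hρ : 0 < ρ) (h : ρ + dist p q ≤ r) :
    massRatio V p ρ ≤ (r / ρ) ^ 2 * massRatio V q r := by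
  have hr : 0 < r := by linarith [dist_nonneg (x := p) (y := q)]
  have : V.real (cyl p ρ) ≤ V.real (cyl q r) :=
    measureReal_mono (cyl_mono h) (measure_cyl_lt_top q r).ne
  rw [massRatio, massRatio, div_pow, div_mul_div_comm, mul_comm (ρ ^ 2), ← div_mul_div_comm,
    div_self (by positivity), one_mul]
  gcongr

/-- The monotone quantity is comparable to the mass ratio, up to the energy. -/
theorem abs_monoQuantity_sub_massRatio_le (hH : LocallyIntegrable H V)
    (hW : Integrable (fun z => ‖H z‖ ^ 2) V) (p : E3) {ρ δ : ℝ} (hρ : 0 < ρ) (hδ : 0 < δ) :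
    |monoQuantity V H p ρ - massRatio V p ρ| ≤
      δ * massRatio V p ρ + (1 / (4 * δ) + 1 / 4) * energy V H p ρ := by
  have hfin := (measure_cyl_lt_top (V := V) p ρ).ne
  have hc : ∀ c : ℝ, IntegrableOn (fun _ => c) (cyl p ρ) V := fun c => integrableOn_const hfin
  have e1 : ∀ c : ℝ, c * massRatio V p ρ = ∫ z in cyl p ρ, c * (ρ ^ 2)⁻¹ ∂V := by
    intro c
    rw [setIntegral_const, massRatio, smul_eq_mul]
    ring
  have e2 : monoQuantity V H p ρ - massRatio V p ρ =
      ∫ z in cyl p ρ, (monoIntegrand H p ρ z - 1 * (ρ ^ 2)⁻¹) ∂V := by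
    rw [integral_sub (integrableOn_monoIntegrand hH hW p ρ) (hc _), ← e1, one_mul]
    rfl
  rw [e2, e1, energy, ← integral_const_mul, ← integral_add (hc _)
    (hW.integrableOn.const_mul _)]
  rw [← Real.norm_eq_abs]
  refine norm_integral_le_of_norm_le ((hc _).add (hW.integrableOn.const_mul _)) ?_
  filter_upwards [ae_restrict_mem (measurableSet_cyl p ρ)] with z hz
  have hz' : ‖z.1 - p‖ < ρ := mem_ball_iff_norm.mp hz
  have h1 : |inner ℝ (H z) (z.1 - p)| ≤ ‖H z‖ * ρ :=
    (abs_real_inner_le_norm _ _).trans (mul_le_mul_of_nonneg_left hz'.le (norm_nonneg _))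
  -- Young's inequality with weight δ, as a completed square.
  have h2 : (ρ ^ 2)⁻¹ * (‖H z‖ * ρ) ≤ δ * (ρ ^ 2)⁻¹ + 1 / (4 * δ) * ‖H z‖ ^ 2 := by
    have h3 : 0 ≤ 1 / (4 * δ) * (2 * δ * ρ⁻¹ - ‖H z‖) ^ 2 := by positivity
    have h4 : 1 / (4 * δ) * (2 * δ * ρ⁻¹ - ‖H z‖) ^ 2 =
        δ * (ρ ^ 2)⁻¹ + 1 / (4 * δ) * ‖H z‖ ^ 2 - (ρ ^ 2)⁻¹ * (‖H z‖ * ρ) := by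
      field_simp
      ring
    linarith
  rw [monoIntegrand, Real.norm_eq_abs]
  have e3 : (ρ ^ 2)⁻¹ * (1 + inner ℝ (H z) (z.1 - p)) + ‖H z‖ ^ 2 / 4 - 1 * (ρ ^ 2)⁻¹ =
      (ρ ^ 2)⁻¹ * inner ℝ (H z) (z.1 - p) + ‖H z‖ ^ 2 / 4 := by ring
  rw [e3]
  refine (abs_add_le _ _).trans ?_
  rw [abs_mul, abs_of_nonneg (by positivity : 0 ≤ (ρ ^ 2)⁻¹),
    abs_of_nonneg (by positivity : 0 ≤ ‖H z‖ ^ 2 / 4)]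
  have h5 : (ρ ^ 2)⁻¹ * |inner ℝ (H z) (z.1 - p)| ≤ (ρ ^ 2)⁻¹ * (‖H z‖ * ρ) :=
    mul_le_mul_of_nonneg_left h1 (by positivity)
  linarith

/-- Away from the boundary the monotone quantity is nondecreasing. -/
theorem IsGeneralizedBoundary.monoQuantity_le (hb : IsGeneralizedBoundary V H σ)
    (hperp : ∀ᵐ z ∂V, ∀ l, ∑ i, z.2.1 l i * H z i = 0)
    (hW : Integrable (fun z => ‖H z‖ ^ 2) V) {p : E3} {s r : ℝ} (hs : 0 < s) (hsr : s ≤ r)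
    (hσ : ∀ᵐ x ∂σ.tv, r ≤ ‖x - p‖) : monoQuantity V H p s ≤ monoQuantity V H p r := by
  rcases hsr.eq_or_lt with rfl | hsr
  · exact le_rfl
  refine (hb.monotonicity hperp hW p hs hsr).trans_eq ?_
  rw [integral_eq_zero_of_ae, mul_zero, add_zero]
  filter_upwards [hσ] with x hx
  rw [profile_eq_zero (pow_le_pow_left₀ (hs.trans hsr).le hx 2), zero_mul]
  rfl

/-- The monotone quantity changes by at most `|σ|/(2d)` if the boundary is at distance `d`. -/
theorem IsGeneralizedBoundary.monoQuantity_le_add (hb : IsGeneralizedBoundary V H σ)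
    [IsFiniteMeasure σ.tv] (hperp : ∀ᵐ z ∂V, ∀ l, ∑ i, z.2.1 l i * H z i = 0)
    (hW : Integrable (fun z => ‖H z‖ ^ 2) V) {p : E3} {s r d : ℝ} (hs : 0 < s) (hsr : s < r)
    (hd : 0 < d) (hσ : ∀ᵐ x ∂σ.tv, d ≤ ‖x - p‖) :
    monoQuantity V H p s ≤ monoQuantity V H p r + d⁻¹ * σ.tv.real univ := by
  refine (hb.monotonicity hperp hW p hs hsr).trans (add_le_add_right ?_ _)
  have hs2 : 0 < s ^ 2 := by positivity
  have hsr2 : s ^ 2 < r ^ 2 := pow_lt_pow_left₀ hsr hs.le two_ne_zero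
  have hbd : ‖∫ x, profile (s ^ 2) (r ^ 2) (‖x - p‖ ^ 2) * inner ℝ (x - p) (σ.dir x) ∂σ.tv‖ ≤
      d⁻¹ * σ.tv.real univ := by
    refine norm_integral_le_of_norm_le_const ?_
    filter_upwards [hσ, σ.norm_dir] with x hx hdir
    have hx0 : 0 < ‖x - p‖ := hd.trans_le hx
    have h1 := profile_le_inv hs2 hsr2 (show 0 < ‖x - p‖ ^ 2 by positivity)
    have h2 := abs_real_inner_le_norm (x - p) (σ.dir x)
    rw [hdir, mul_one] at h2
    rw [norm_mul, Real.norm_of_nonneg (profile_nonneg hs2 hsr2 _), Real.norm_eq_abs]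
    calc _ ≤ (‖x - p‖ ^ 2)⁻¹ * ‖x - p‖ := mul_le_mul h1 h2 (abs_nonneg _) (by positivity)
      _ = ‖x - p‖⁻¹ := by field_simp
      _ ≤ d⁻¹ := inv_anti₀ hd hx
  have := (le_abs_self _).trans hbd
  have h0 : 0 ≤ d⁻¹ * σ.tv.real univ := by positivity
  linarith

/-- Existence of the density, with the monotone quantities as upper bounds. -/
theorem IsGeneralizedBoundary.exists_density (hb : IsGeneralizedBoundary V H σ)
    (hperp : ∀ᵐ z ∂V, ∀ l, ∑ i, z.2.1 l i * H z i = 0)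
    (hW : Integrable (fun z => ‖H z‖ ^ 2) V) {p : E3} {d : ℝ} (hd : 0 < d)
    (hσ : ∀ᵐ x ∂σ.tv, d ≤ ‖x - p‖) : ∃ L : ℝ, Tendsto (massRatio V p) (𝓝[>] 0) (𝓝 L) ∧
      Tendsto (energy V H p) (𝓝[>] 0) (𝓝 0) ∧ ∀ ρ ∈ Ioo 0 d, L ≤ monoQuantity V H p ρ := by
  set w := energy V H p with hw
  have hmono : MonotoneOn (monoQuantity V H p) (Ioo 0 d) := fun s hs r hr hsr =>
    hb.monoQuantity_le hperp hW hs.1 hsr (hσ.mono fun x hx => hr.2.le.trans hx)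
  have hcomp : ∀ ρ, 0 < ρ → ∀ δ, 0 < δ → |monoQuantity V H p ρ - massRatio V p ρ| ≤
      δ * massRatio V p ρ + (1 / (4 * δ) + 1 / 4) * w ρ := fun ρ hρ δ hδ =>
    abs_monoQuantity_sub_massRatio_le hb.1 hW p hρ hδ
  have hwW : ∀ ρ, w ρ ≤ ∫ z, ‖H z‖ ^ 2 ∂V := energy_le_total hW p
  have hbdd : BddBelow (monoQuantity V H p '' Ioo 0 d) := by
    refine ⟨-((1 / (4 * 1) + 1 / 4) * ∫ z, ‖H z‖ ^ 2 ∂V), ?_⟩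
    rintro _ ⟨ρ, hρ, rfl⟩
    -- With δ = 1 the mass ratio cancels, leaving a lower bound by the total energy alone.
    have h1 := (abs_le.mp (hcomp ρ hρ.1 1 one_pos)).1
    have h2 := hwW ρ
    linarith
  have hlim := hmono.tendsto_nhdsWithin_Ioo_right ⟨d / 2, by constructor <;> linarith⟩ hbdd
  set L := sInf (monoQuantity V H p '' Ioo 0 d) with hL
  -- the mass ratios are bounded near zero
  obtain ⟨B, hB0, hB⟩ : ∃ B, 0 ≤ B ∧ ∀ ρ ∈ Ioc 0 (d / 2), massRatio V p ρ ≤ B := by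
    refine ⟨2 * (|monoQuantity V H p (d / 2)| +
      (1 / (4 * (1 / 2)) + 1 / 4) * ∫ z, ‖H z‖ ^ 2 ∂V), ?_, fun ρ hρ => ?_⟩
    · have : 0 ≤ ∫ z, ‖H z‖ ^ 2 ∂V := integral_nonneg fun _ => sq_nonneg _
      positivity
    · have h1 := (abs_le.mp (hcomp ρ hρ.1 (1 / 2) (by norm_num))).1
      have h2 := hwW ρ
      have h3 : monoQuantity V H p ρ ≤ monoQuantity V H p (d / 2) :=
        hmono ⟨hρ.1, by linarith [hρ.2]⟩ ⟨by linarith, by linarith⟩ hρ.2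
      have h4 := le_abs_self (monoQuantity V H p (d / 2))
      linarith
  -- No mass sits over p, so dominated convergence makes the energy of shrinking balls vanish.
  have hpt : V {z | z.1 = p} = 0 := by
    have hle : ∀ ρ ∈ Ioc 0 (d / 2), V.real {z | z.1 = p} ≤ B * ρ ^ 2 := by
      intro ρ hρ
      have h1 : V.real {z | z.1 = p} ≤ V.real (cyl p ρ) := by
        refine measureReal_mono (fun z hz => ?_) (measure_cyl_lt_top p ρ).ne
        have hz' : z.1 = p := hz
        exact hz' ▸ Metric.mem_ball_self hρ.1
      have h2 := hB ρ hρ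
      have hρ0 := hρ.1
      rw [massRatio, div_le_iff₀ (by positivity)] at h2
      exact h1.trans h2
    have ht : Tendsto (fun ρ : ℝ => B * ρ ^ 2) (𝓝[>] 0) (𝓝 0) := by
      have : Tendsto (fun ρ : ℝ => B * ρ ^ 2) (𝓝 0) (𝓝 (B * 0 ^ 2)) :=
        (continuous_const.mul (continuous_pow 2)).tendsto 0
      simpa using this.mono_left nhdsWithin_le_nhds
    have h0 : V.real {z | z.1 = p} ≤ 0 := by
      refine ge_of_tendsto ht ?_
      filter_upwards [Ioc_mem_nhdsGT (show (0 : ℝ) < d / 2 by linarith)] with ρ hρ using hle ρ hρ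
    have hfin : V {z | z.1 = p} ≠ ⊤ := by
      have hsub : {z : GBundle | z.1 = p} ⊆ cyl p 1 := fun z hz =>
        (show z.1 = p from hz) ▸ Metric.mem_ball_self one_pos
      exact ((measure_mono hsub).trans_lt (measure_cyl_lt_top p 1)).ne
    exact (measureReal_eq_zero_iff hfin).mp (le_antisymm h0 measureReal_nonneg)
  have hw0 : Tendsto w (𝓝[>] 0) (𝓝 0) := by
    have h1 : Tendsto (fun ρ => ∫ z, (cyl p ρ).indicator (fun z => ‖H z‖ ^ 2) z ∂V) (𝓝[>] 0)
        (𝓝 (∫ _, (0 : ℝ) ∂V)) := by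
      refine tendsto_integral_filter_of_dominated_convergence (fun z => ‖H z‖ ^ 2)
        (Eventually.of_forall fun ρ => hW.aestronglyMeasurable.indicator (measurableSet_cyl p ρ))
        (Eventually.of_forall fun ρ => Eventually.of_forall fun z => ?_) hW ?_
      · rw [Real.norm_of_nonneg (indicator_nonneg (fun _ _ => sq_nonneg _) z)]
        exact indicator_le_self' (fun _ _ => sq_nonneg _) z
      · have hne : ∀ᵐ z ∂V, z.1 ≠ p := by
          rw [ae_iff]; simpa using hpt
        filter_upwards [hne] with z hz
        have hpos : 0 < ‖z.1 - p‖ := norm_pos_iff.mpr (sub_ne_zero.mpr hz)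
        refine tendsto_const_nhds.congr' ?_
        filter_upwards [Ioo_mem_nhdsGT hpos] with ρ hρ
        rw [indicator_of_notMem]
        intro h
        exact (mem_ball_iff_norm.mp h).not_ge hρ.2.le
    rw [integral_zero] at h1
    refine h1.congr fun ρ => ?_
    rw [integral_indicator (measurableSet_cyl p ρ)]
    rfl
  refine ⟨L, ?_, hw0, fun ρ hρ => csInf_le hbdd ⟨ρ, hρ, rfl⟩⟩
  have hdiff : Tendsto (fun ρ => monoQuantity V H p ρ - massRatio V p ρ) (𝓝[>] 0) (𝓝 0) := by
    rw [Metric.tendsto_nhds]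
    intro ε hε
    set δ := ε / (2 * (B + 1)) with hδ
    have hδ0 : 0 < δ := by positivity
    have hδB : δ * B < ε / 2 := by
      rw [hδ, div_mul_eq_mul_div, div_lt_div_iff₀ (by positivity) two_pos]
      nlinarith
    have hw' : Tendsto (fun ρ => (1 / (4 * δ) + 1 / 4) * w ρ) (𝓝[>] 0) (𝓝 0) := by
      simpa using hw0.const_mul (1 / (4 * δ) + 1 / 4)
    filter_upwards [Ioc_mem_nhdsGT (show (0 : ℝ) < d / 2 by linarith),
      hw'.eventually_lt_const (show 0 < ε / 2 by linarith)] with ρ hρ hwρ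
    rw [Real.dist_eq, sub_zero]
    have h1 := hcomp ρ hρ.1 δ hδ0
    have h2 := mul_le_mul_of_nonneg_left (hB ρ hρ) hδ0.le
    linarith
  simpa using hlim.sub hdiff

/-- Upper semicontinuity of the density limits. -/
theorem IsGeneralizedBoundary.eventually_density_lt (hb : IsGeneralizedBoundary V H σ)
    (hW : Integrable (fun z => ‖H z‖ ^ 2) V) {p : E3} {d L y : ℝ} (hd : 0 < d)
    (hL : Tendsto (massRatio V p) (𝓝[>] 0) (𝓝 L))
    (hw : Tendsto (energy V H p) (𝓝[>] 0) (𝓝 0)) (hy : L < y) :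
    ∃ ρ ∈ Ioo 0 d, ∀ᶠ q in 𝓝 p, monoQuantity V H q ρ < y := by
  -- choose the loss factor
  obtain ⟨δ, hδ0, hδ⟩ : ∃ δ : ℝ, 0 < δ ∧ (1 + δ) ^ 3 * L < y := by
    have h1 : Tendsto (fun δ : ℝ => (1 + δ) ^ 3 * L) (𝓝[>] 0) (𝓝 L) := by
      have : Tendsto (fun δ : ℝ => (1 + δ) ^ 3 * L) (𝓝 0) (𝓝 ((1 + 0) ^ 3 * L)) :=
        (by fun_prop : Continuous fun δ : ℝ => (1 + δ) ^ 3 * L).tendsto 0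
      simpa using this.mono_left nhdsWithin_le_nhds
    obtain ⟨δ, h2, h3⟩ := ((h1.eventually_lt_const hy).and self_mem_nhdsWithin).exists
    exact ⟨δ, h3, h2⟩
  have h1 : Tendsto (fun r => (1 + δ) ^ 3 * massRatio V p r +
      (1 / (4 * δ) + 1 / 4) * energy V H p r) (𝓝[>] 0) (𝓝 ((1 + δ) ^ 3 * L)) := by
    simpa using (hL.const_mul ((1 + δ) ^ 3)).add (hw.const_mul (1 / (4 * δ) + 1 / 4))
  obtain ⟨r, hr, hr'⟩ := ((h1.eventually_lt_const hδ).and (Ioo_mem_nhdsGT hd)).exists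
  have hρ0 : 0 < r / (1 + δ) := div_pos hr'.1 (by linarith)
  refine ⟨r / (1 + δ), ⟨hρ0, (div_le_self hr'.1.le (by linarith)).trans_lt hr'.2⟩, ?_⟩
  set ρ := r / (1 + δ) with hρ
  have hrρ : r = (1 + δ) * ρ := by rw [hρ]; field_simp
  filter_upwards [Metric.ball_mem_nhds p (show 0 < δ * ρ by positivity)] with q hq
  rw [Metric.mem_ball] at hq
  have hqr : ρ + dist q p ≤ r := by rw [hrρ]; linarith
  have h2 := (abs_le.mp (abs_monoQuantity_sub_massRatio_le hb.1 hW q hρ0 hδ0)).2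
  have h3 := massRatio_le (V := V) hρ0 hqr
  have h4 := energy_mono hW hqr
  have h5 : r / ρ = 1 + δ := by rw [hrρ]; field_simp
  rw [h5] at h3
  have h6 : (1 + δ) * massRatio V q ρ ≤ (1 + δ) * ((1 + δ) ^ 2 * massRatio V p r) :=
    mul_le_mul_of_nonneg_left h3 (by linarith)
  have h7 : (1 / (4 * δ) + 1 / 4) * energy V H q ρ ≤ (1 / (4 * δ) + 1 / 4) * energy V H p r :=
    mul_le_mul_of_nonneg_left h4 (by positivity)
  nlinarith

/-- Density bound from quadratic growth at infinity. -/
theorem IsGeneralizedBoundary.density_le (hb : IsGeneralizedBoundary V H σ)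
    [IsFiniteMeasure σ.tv] (hperp : ∀ᵐ z ∂V, ∀ l, ∑ i, z.2.1 l i * H z i = 0)
    (hW : Integrable (fun z => ‖H z‖ ^ 2) V) {p : E3} {d L k : ℝ} (hd : 0 < d)
    (hσ : ∀ᵐ x ∂σ.tv, d ≤ ‖x - p‖) (hL : ∀ ρ ∈ Ioo 0 d, L ≤ monoQuantity V H p ρ)
    (hk : ∀ᶠ R in atTop, massRatio V 0 R ≤ k) :
    L ≤ 8 * k + 1 / 2 * (∫ z, ‖H z‖ ^ 2 ∂V) + d⁻¹ * σ.tv.real univ := by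
  have hev : ∀ᶠ r : ℝ in atTop, massRatio V 0 (r + ‖p‖) ≤ k :=
    (tendsto_atTop_add_const_right _ ‖p‖ tendsto_id).eventually hk
  -- Taking r ≥ d + |p| gives (r + |p|)/r ≤ 2; together with the factor 2 from δ = 1 this produces 8
  -- = 2 · 2².
  obtain ⟨r, hr, hr'⟩ := (hev.and (eventually_ge_atTop (d + ‖p‖))).exists
  have hr0 : 0 < r := by linarith [norm_nonneg p]
  have h1 := hL (d / 2) ⟨by linarith, by linarith⟩
  have h2 := hb.monoQuantity_le_add hperp hW (show 0 < d / 2 by linarith)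
    (show d / 2 < r by linarith [norm_nonneg p]) hd hσ
  have h3 := (abs_le.mp (abs_monoQuantity_sub_massRatio_le hb.1 hW p hr0 one_pos)).2
  have h4 := energy_le_total hW p r
  have h5 := massRatio_le (V := V) (p := p) (q := 0) (r := r + ‖p‖) hr0 (by simp)
  have h6 : ((r + ‖p‖) / r) ^ 2 ≤ 2 ^ 2 := by
    refine pow_le_pow_left₀ (by positivity) ?_ 2
    rw [div_le_iff₀ hr0]
    linarith
  have h7 : ((r + ‖p‖) / r) ^ 2 * massRatio V 0 (r + ‖p‖) ≤ 2 ^ 2 * k :=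
    mul_le_mul h6 hr (massRatio_nonneg _ _) (by norm_num)
  linarith

end Density

/-! ### Area of discs and density at points with a tangent plane -/

/-- The orthogonal projection onto `P` as a linear map. -/
noncomputable def tangLin (P : G23) : E3 →ₗ[ℝ] E3 where
  toFun := tang P
  map_add' x y := by ext i; simp [mul_add, Finset.sum_add_distrib]
  map_smul' c x := by ext i; simp [Finset.mul_sum, mul_left_comm]

/-- The plane `P` as a linear subspace. -/
noncomputable def planeSubmodule (P : G23) : Submodule ℝ E3 := LinearMap.range (tangLin P)

theorem mem_planeSubmodule {P : G23} {y : E3} : y ∈ planeSubmodule P ↔ tang P y = y := by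
  constructor
  · rintro ⟨x, rfl⟩
    exact tang_tang P x
  · exact fun h => ⟨y, h⟩

theorem coe_planeSubmodule (P : G23) : (planeSubmodule P : Set E3) = planeSet P := by
  ext y
  rw [SetLike.mem_coe, mem_planeSubmodule]
  exact ⟨fun h i => by conv_rhs => rw [← h]
                       rfl, fun h => by ext i; exact h i⟩

/-- The rank of a projection is its trace, and the trace is 2 by definition of the Grassmannian. -/
theorem finrank_planeSubmodule (P : G23) : Module.finrank ℝ (planeSubmodule P) = 2 := by
  have hproj : LinearMap.IsProj (planeSubmodule P) (tangLin P) :=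
    ⟨fun x => ⟨x, rfl⟩, fun x hx => mem_planeSubmodule.mp hx⟩
  have h := hproj.trace
  rw [LinearMap.trace_eq_sum_inner _ (EuclideanSpace.basisFun (Fin 3) ℝ)] at h
  have h2 : ∑ i, inner ℝ ((EuclideanSpace.basisFun (Fin 3) ℝ) i)
      (tangLin P ((EuclideanSpace.basisFun (Fin 3) ℝ) i)) = 2 := by
    rw [← P.2.2.2]
    refine Finset.sum_congr rfl fun i _ => ?_
    have : tangLin P ((EuclideanSpace.basisFun (Fin 3) ℝ) i) i = P.1 i i := by
      change ∑ j, P.1 i j * (EuclideanSpace.basisFun (Fin 3) ℝ) i j = _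
      simp
    rw [EuclideanSpace.basisFun_apply, EuclideanSpace.inner_single_left]
    simpa using this
  rw [h2] at h
  exact_mod_cast h.symm

/-- The area of a disc in a plane. -/
theorem measure_plane_inter_ball (P : G23) (s : ℝ) :
    (μHE[2] : Measure E3) (planeSet P ∩ Metric.ball 0 s) =
      ENNReal.ofReal s ^ 2 * ENNReal.ofReal Real.pi := by
  have hfin := finrank_planeSubmodule P
  have : Nontrivial (planeSubmodule P) :=
    Module.nontrivial_of_finrank_pos (R := ℝ) (by rw [hfin]; norm_num)
  have himg : planeSet P ∩ Metric.ball 0 s =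
      (planeSubmodule P).subtypeₗᵢ '' Metric.ball (0 : planeSubmodule P) s := by
    ext y
    rw [← coe_planeSubmodule]
    constructor
    · rintro ⟨h1, h2⟩
      exact ⟨⟨y, h1⟩, by simpa using h2, rfl⟩
    · rintro ⟨⟨x, hx⟩, h2, rfl⟩
      exact ⟨hx, by simpa using h2⟩
  have hvol := InnerProductSpace.euclideanHausdorffMeasure_eq_volume (V := planeSubmodule P)
  rw [hfin] at hvol
  rw [himg, (planeSubmodule P).subtypeₗᵢ.isometry.euclideanHausdorffMeasure_image, hvol,
    InnerProductSpace.volume_ball_of_dim_even (k := 1) (by rw [hfin]), hfin]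
  simp

/-- A continuous radial cut-off, equal to `1` on `B_c` and vanishing off `B_d`. -/
noncomputable def bump (c d : ℝ) (y : E3) : ℝ := max 0 (min 1 ((d - ‖y‖) / (d - c)))

theorem continuous_bump (c d : ℝ) : Continuous (bump c d) := by
  unfold bump; fun_prop

theorem bump_nonneg (c d : ℝ) (y : E3) : 0 ≤ bump c d y := le_max_left _ _

theorem bump_le_indicator {c d : ℝ} (h : c < d) (y : E3) :
    bump c d y ≤ (Metric.ball (0 : E3) d).indicator 1 y := by
  by_cases hy : y ∈ Metric.ball (0 : E3) d
  · rw [indicator_of_mem hy]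
    exact max_le zero_le_one (min_le_left _ _)
  · rw [indicator_of_notMem hy]
    rw [mem_ball_zero_iff, not_lt] at hy
    exact max_le le_rfl (min_le_of_right_le (div_nonpos_of_nonpos_of_nonneg (by linarith)
      (by linarith)))

theorem indicator_le_bump {c d : ℝ} (h : c < d) (y : E3) :
    (Metric.ball (0 : E3) c).indicator 1 y ≤ bump c d y := by
  refine indicator_apply_le' (fun hy => ?_) (fun _ => bump_nonneg _ _ _)
  rw [mem_ball_zero_iff] at hy
  refine le_max_of_le_right (le_min le_rfl ?_)
  rw [Pi.one_apply, one_le_div (by linarith)]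
  linarith

theorem hasCompactSupport_bump {c d : ℝ} (h : c < d) : HasCompactSupport (bump c d) := by
  refine HasCompactSupport.intro (isCompact_closedBall 0 d) fun y hy => ?_
  refine le_antisymm ((bump_le_indicator h y).trans_eq (indicator_of_notMem (fun h' => hy ?_) _))
    (bump_nonneg _ _ _)
  exact Metric.ball_subset_closedBall h'

theorem integral_plane_bump_le (P : G23) {c d : ℝ} (h : c < d) (hd : 0 ≤ d) :
    ∫ y in planeSet P, bump c d y ∂(μHE[2] : Measure E3) ≤ Real.pi * d ^ 2 := by
  have hm : (μHE[2] : Measure E3).restrict (planeSet P) (Metric.ball 0 d) =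
      ENNReal.ofReal d ^ 2 * ENNReal.ofReal Real.pi := by
    rw [Measure.restrict_apply measurableSet_ball, inter_comm, measure_plane_inter_ball]
  have hfin : (μHE[2] : Measure E3).restrict (planeSet P) (Metric.ball 0 d) ≠ ⊤ := by
    rw [hm]; finiteness
  have hI : Integrable ((Metric.ball (0 : E3) d).indicator (1 : E3 → ℝ))
      ((μHE[2] : Measure E3).restrict (planeSet P)) := by
    rw [integrable_indicator_iff measurableSet_ball]
    exact integrableOn_const hfin
  calc _ ≤ ∫ y in planeSet P, (Metric.ball (0 : E3) d).indicator (1 : E3 → ℝ) y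
        ∂(μHE[2] : Measure E3) := by
        refine integral_mono_of_nonneg (Eventually.of_forall fun y => bump_nonneg c d y) hI
          (Eventually.of_forall fun y => bump_le_indicator h y)
    _ = _ := by
        rw [integral_indicator_one measurableSet_ball, measureReal_def, hm]
        rw [ENNReal.toReal_mul, ENNReal.toReal_pow, ENNReal.toReal_ofReal hd,
          ENNReal.toReal_ofReal Real.pi_pos.le, mul_comm]

theorem le_integral_plane_bump (P : G23) {c d : ℝ} (h : c < d) (hc : 0 ≤ c) :
    Real.pi * c ^ 2 ≤ ∫ y in planeSet P, bump c d y ∂(μHE[2] : Measure E3) := by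
  have hm : ∀ s, (μHE[2] : Measure E3).restrict (planeSet P) (Metric.ball 0 s) =
      ENNReal.ofReal s ^ 2 * ENNReal.ofReal Real.pi := fun s => by
    rw [Measure.restrict_apply measurableSet_ball, inter_comm, measure_plane_inter_ball]
  have hI : ∀ s, Integrable ((Metric.ball (0 : E3) s).indicator (1 : E3 → ℝ))
      ((μHE[2] : Measure E3).restrict (planeSet P)) := by
    intro s
    rw [integrable_indicator_iff measurableSet_ball]
    refine integrableOn_const (ne_of_eq_of_ne (hm s) ?_)
    finiteness
  have hIb : Integrable (bump c d) ((μHE[2] : Measure E3).restrict (planeSet P)) :=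
    (hI d).mono' (continuous_bump c d).aestronglyMeasurable (Eventually.of_forall fun y => by
      rw [Real.norm_of_nonneg (bump_nonneg c d y)]
      exact bump_le_indicator h y)
  calc _ = ∫ y in planeSet P, (Metric.ball (0 : E3) c).indicator (1 : E3 → ℝ) y
        ∂(μHE[2] : Measure E3) := by
        rw [integral_indicator_one measurableSet_ball, measureReal_def, hm]
        rw [ENNReal.toReal_mul, ENNReal.toReal_pow, ENNReal.toReal_ofReal hc,
          ENNReal.toReal_ofReal Real.pi_pos.le, mul_comm]
    _ ≤ _ := integral_mono (hI c) hIb fun y => indicator_le_bump h y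

/-- At a point with an approximate tangent plane, the density is the multiplicity. -/
theorem density_eq_of_isApproxTangentPlane {V : Measure GBundle} {M : Set E3} {θ : E3 → ℝ}
    (h : IsIntegerRectifiable V M θ) {x : E3} {P : G23} (hP : IsApproxTangentPlane M θ x P)
    (hθx : 0 ≤ θ x) {L : ℝ} (hL : Tendsto (massRatio V x) (𝓝[>] 0) (𝓝 L)) :
    L = Real.pi * θ x := by
  have hVloc := h.1
  have hwloc := locallyFinite_weight V
  have hint : ∀ g : E3 → ℝ, ∫ y in M, g y * θ y ∂(μHE[2] : Measure E3) = ∫ y, g y ∂(weight V) := by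
    intro g
    rw [h.weight_eq, integral_withDensity_eq_integral_toReal_smul₀ h.2.2.1.ennreal_ofReal
      (Eventually.of_forall fun _ => ENNReal.ofReal_lt_top)]
    refine integral_congr_ae ?_
    filter_upwards [h.2.2.2.1] with y hy
    obtain ⟨m, -, hm⟩ := hy
    rw [ENNReal.toReal_ofReal (by rw [hm]; positivity), smul_eq_mul, mul_comm]
  have hmass : ∀ r, (weight V).real (Metric.ball x r) = V.real (cyl x r) := by
    intro r
    rw [measureReal_def, weight, Measure.map_apply measurable_fst measurableSet_ball]
    rfl
  have hball : ∀ r : ℝ, 0 < r → ∀ c y, (r⁻¹ • (y - x) ∈ Metric.ball (0 : E3) c ↔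
      y ∈ Metric.ball x (c * r)) := by
    intro r hr c y
    rw [mem_ball_zero_iff, mem_ball_iff_norm, norm_smul, norm_inv, Real.norm_of_nonneg hr.le,
      inv_mul_eq_div, div_lt_iff₀ hr]
  have hI : ∀ r, Integrable ((Metric.ball x r).indicator (1 : E3 → ℝ)) (weight V) := by
    intro r
    rw [integrable_indicator_iff measurableSet_ball]
    exact integrableOn_const measure_ball_lt_top.ne
  have hIb : ∀ r : ℝ, 0 < r → ∀ c d, c < d →
      Integrable (fun y => bump c d (r⁻¹ • (y - x))) (weight V) := by
    intro r hr c d hcd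
    refine (hI (d * r)).mono' ?_ (Eventually.of_forall fun y => ?_)
    · refine Continuous.aestronglyMeasurable ?_
      exact (continuous_bump c d).comp (by fun_prop)
    · rw [Real.norm_of_nonneg (bump_nonneg _ _ _)]
      refine (bump_le_indicator hcd _).trans_eq ?_
      simp [indicator, hball r hr]
  have htend : ∀ c d, c < d → Tendsto (fun r : ℝ => (r ^ 2)⁻¹ *
      ∫ y, bump c d (r⁻¹ • (y - x)) ∂(weight V)) (𝓝[>] 0)
      (𝓝 (θ x * ∫ y in planeSet P, bump c d y ∂(μHE[2] : Measure E3))) := by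
    intro c d hcd
    have := hP (bump c d) (continuous_bump c d) (hasCompactSupport_bump hcd)
    simpa only [hint] using this
  -- Weak convergence only tests continuous functions, so the indicator of the unit ball is squeezed
  -- between bumps with slightly larger and slightly smaller supports; d ↓ 1 and c ↑ 1 then close
  -- the gap.
  have hupper : ∀ d, 1 < d → L ≤ θ x * (Real.pi * d ^ 2) := by
    intro d hd
    refine (le_of_tendsto_of_tendsto hL (htend 1 d hd) ?_).trans
      (mul_le_mul_of_nonneg_left (integral_plane_bump_le P hd (by linarith)) hθx)
    filter_upwards [self_mem_nhdsWithin] with r hr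
    have hr : 0 < r := hr
    rw [massRatio, div_eq_inv_mul, ← hmass, ← integral_indicator_one measurableSet_ball]
    refine mul_le_mul_of_nonneg_left (integral_mono (hI r) (hIb r hr 1 d hd) fun y => ?_)
      (by positivity)
    refine le_trans (le_of_eq ?_) (indicator_le_bump hd _)
    simp [indicator, hball r hr]
  have hlower : ∀ c, 0 ≤ c → c < 1 → θ x * (Real.pi * c ^ 2) ≤ L := by
    intro c hc0 hc
    refine (mul_le_mul_of_nonneg_left (le_integral_plane_bump P hc hc0) hθx).trans
      (le_of_tendsto_of_tendsto (htend c 1 hc) hL ?_)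
    filter_upwards [self_mem_nhdsWithin] with r hr
    have hr : 0 < r := hr
    rw [massRatio, div_eq_inv_mul, ← hmass, ← integral_indicator_one measurableSet_ball]
    refine mul_le_mul_of_nonneg_left (integral_mono (hIb r hr c 1 hc) (hI r) fun y => ?_)
      (by positivity)
    refine (bump_le_indicator hc _).trans (le_of_eq ?_)
    simp [indicator, hball r hr]
  have hcont : Tendsto (fun t : ℝ => θ x * (Real.pi * t ^ 2)) (𝓝 1) (𝓝 (Real.pi * θ x)) := by
    have : Tendsto (fun t : ℝ => θ x * (Real.pi * t ^ 2)) (𝓝 1) (𝓝 (θ x * (Real.pi * 1 ^ 2))) :=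
      (by fun_prop : Continuous fun t : ℝ => θ x * (Real.pi * t ^ 2)).tendsto 1
    convert this using 2
    ring
  refine le_antisymm ?_ ?_
  · refine ge_of_tendsto (hcont.mono_left (nhdsWithin_le_nhds (s := Ioi 1))) ?_
    filter_upwards [self_mem_nhdsWithin] with d hd using hupper d hd
  · refine le_of_tendsto (hcont.mono_left (nhdsWithin_le_nhds (s := Iio 1))) ?_
    filter_upwards [Ioo_mem_nhdsLT (show (0 : ℝ) < 1 from one_pos)] with c hc
    exact hlower c hc.1.le hc.2

/-! ### Covering argument for null sets -/

/-- A null set of a Radon measure at all of whose points the mass of small balls is at least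
quadratic is negligible for the two-dimensional Hausdorff measure. -/
theorem hausdorffMeasure_eq_zero_of_mass_ge {μ : Measure E3} [IsLocallyFiniteMeasure μ]
    {E : Set E3} (h0 : μ E = 0)
    (hE : ∀ p ∈ E, ∀ᶠ r in 𝓝[>] (0 : ℝ), ENNReal.ofReal (r ^ 2) ≤ μ (Metric.ball p r)) :
    (μHE[2] : Measure E3) E = 0 := by
  have hstep : ∀ n : ℕ, ∃ (u : Set E3) (r : E3 → ℝ), u.Countable ∧
      (∀ b ∈ u, 0 < r b ∧ r b ≤ 1 / ((n : ℝ) + 1)) ∧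
      (E ⊆ ⋃ b ∈ u, Metric.ball b (4 * r b)) ∧
      ∑' b : u, ENNReal.ofReal (r b ^ 2) ≤ ENNReal.ofReal (1 / ((n : ℝ) + 1)) := by
    intro n
    have hε : (0 : ℝ) < 1 / ((n : ℝ) + 1) := by positivity
    obtain ⟨U, hEU, hU, hμU⟩ := E.exists_isOpen_lt_of_lt (μ := μ)
      (ENNReal.ofReal (1 / ((n : ℝ) + 1))) (by rw [h0]; exact ENNReal.ofReal_pos.mpr hε)
    have hchoose : ∀ p, ∃ r : ℝ, p ∈ E → 0 < r ∧ r ≤ 1 / ((n : ℝ) + 1) ∧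
        Metric.ball p r ⊆ U ∧ ENNReal.ofReal (r ^ 2) ≤ μ (Metric.ball p r) := by
      intro p
      by_cases hp : p ∈ E
      · obtain ⟨δ, hδ, hδU⟩ := Metric.isOpen_iff.mp hU p (hEU hp)
        obtain ⟨r, hr, hr'⟩ := ((hE p hp).and (Ioo_mem_nhdsGT (lt_min hδ hε))).exists
        exact ⟨r, fun _ => ⟨hr'.1, (hr'.2.trans_le (min_le_right _ _)).le,
          (Metric.ball_subset_ball (hr'.2.trans_le (min_le_left _ _)).le).trans hδU, hr⟩⟩
      · exact ⟨0, fun h => absurd h hp⟩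
    choose r hr using hchoose
    -- Vitali enlargement needs a factor above 3. The choice 4 gives diameters at most 8r, hence the
    -- constant 64 = 8² in the sum of squares.
    obtain ⟨u, huE, hdisj, hcov⟩ := Vitali.exists_disjoint_subfamily_covering_enlargement_ball E
      (fun p => p) r (1 / ((n : ℝ) + 1)) (fun p hp => (hr p hp).2.1) 4 (by norm_num)
    have hcount : u.Countable := hdisj.countable_of_isOpen (fun _ _ => Metric.isOpen_ball)
      fun p hp => ⟨p, Metric.mem_ball_self (hr p (huE hp)).1⟩
    refine ⟨u, r, hcount, fun b hb => ⟨(hr b (huE hb)).1, (hr b (huE hb)).2.1⟩, fun p hp => ?_, ?_⟩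
    · obtain ⟨b, hb, hsub⟩ := hcov p hp
      exact mem_biUnion hb (hsub (Metric.mem_ball_self (hr p hp).1))
    · calc ∑' b : u, ENNReal.ofReal (r b ^ 2) ≤ ∑' b : u, μ (Metric.ball b.1 (r b)) :=
            ENNReal.tsum_le_tsum fun b => (hr b.1 (huE b.2)).2.2.2
        _ = μ (⋃ b ∈ u, Metric.ball b (r b)) :=
            (measure_biUnion hcount hdisj fun _ _ => measurableSet_ball).symm
        _ ≤ μ U := measure_mono (iUnion₂_subset fun b hb => (hr b (huE hb)).2.2.1)
        _ ≤ _ := hμU.le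
  choose u r hcount hr hcov hsum using hstep
  have hcoe : ∀ n, Countable (u n) := fun n => (hcount n).to_subtype
  have h1 : Tendsto (fun n : ℕ => ENNReal.ofReal (1 / ((n : ℝ) + 1))) atTop (𝓝 0) := by
    rw [← ENNReal.ofReal_zero]
    exact ENNReal.tendsto_ofReal tendsto_one_div_add_atTop_nhds_zero_nat
  have h8 : Tendsto (fun n : ℕ => 8 * ENNReal.ofReal (1 / ((n : ℝ) + 1))) atTop (𝓝 0) := by
    simpa using ENNReal.Tendsto.const_mul h1 (Or.inr (by norm_num : (8 : ℝ≥0∞) ≠ ⊤))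
  have h64 : Tendsto (fun n : ℕ => 64 * ENNReal.ofReal (1 / ((n : ℝ) + 1))) atTop (𝓝 0) := by
    simpa using ENNReal.Tendsto.const_mul h1 (Or.inr (by norm_num : (64 : ℝ≥0∞) ≠ ⊤))
  have hdiam : ∀ n (b : u n), Metric.ediam (Metric.ball b.1 (4 * r n b)) ≤
      8 * ENNReal.ofReal (r n b) := by
    intro n b
    refine (Metric.ediam_mono (Metric.ball_subset_closedBall)).trans ?_
    rw [← Metric.closedEBall_ofReal (by linarith [(hr n b b.2).1])]
    refine Metric.ediam_closedEBall_le.trans_eq ?_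
    rw [ENNReal.ofReal_mul (by norm_num), ← mul_assoc]
    norm_num
  have hle := Measure.hausdorffMeasure_le_liminf_tsum (2 : ℝ) E (l := atTop)
    (fun n : ℕ => 8 * ENNReal.ofReal (1 / ((n : ℝ) + 1))) h8
    (fun n (b : u n) => Metric.ball b.1 (4 * r n b))
    (Eventually.of_forall fun n b => (hdiam n b).trans (by
      gcongr
      exact (hr n b b.2).2))
    (Eventually.of_forall fun n => by simpa only [biUnion_eq_iUnion] using hcov n)
  have hbound : ∀ n, ∑' b : u n, Metric.ediam (Metric.ball b.1 (4 * r n b)) ^ (2 : ℝ) ≤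
      64 * ENNReal.ofReal (1 / ((n : ℝ) + 1)) := by
    intro n
    calc _ ≤ ∑' b : u n, 64 * ENNReal.ofReal (r n b ^ 2) := by
          refine ENNReal.tsum_le_tsum fun b => ?_
          rw [ENNReal.rpow_two]
          refine (pow_le_pow_left₀ zero_le (hdiam n b) 2).trans_eq ?_
          rw [mul_pow, ENNReal.ofReal_pow (hr n b b.2).1.le]
          norm_num
      _ ≤ _ := by
          rw [ENNReal.tsum_mul_left]
          gcongr
          exact hsum n
  have hz : Measure.hausdorffMeasure (2 : ℝ) E = 0 := by
    refine le_antisymm (hle.trans ?_) zero_le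
    refine (liminf_le_liminf (Eventually.of_forall hbound)).trans_eq ?_
    exact h64.liminf_eq
  rw [Measure.euclideanHausdorffMeasure_def, Measure.smul_apply]
  norm_num
  right
  exact hz

/-! ### Change of carrier and passage to the hypotheses of the theorem -/

/-- An integer rectifiable varifold does not change with the carrier and the multiplicity on null
sets. -/
theorem IsIntegerRectifiable.congr {V : Measure GBundle} {M M' : Set E3} {θ θ' : E3 → ℝ}
    (h : IsIntegerRectifiable V M θ) (hM : M =ᵐ[(μHE[2] : Measure E3)] M')
    (hθ : θ =ᵐ[(μHE[2] : Measure E3).restrict M] θ') : IsIntegerRectifiable V M' θ' := by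
  have hres : (μHE[2] : Measure E3).restrict M = (μHE[2] : Measure E3).restrict M' :=
    Measure.restrict_congr_set hM
  obtain ⟨h1, ⟨h2, F, hF, hF0⟩, h3, h4, T, h5, h6, h7⟩ := h
  refine ⟨h1, ⟨h2.congr hM, F, hF, ?_⟩, ?_, ?_, T, ?_, ?_, ?_⟩
  · rw [← hF0]
    exact (measure_congr (hM.diff (ae_eq_refl _))).symm
  · rw [← hres]
    exact h3.congr hθ
  · rw [← hres]
    filter_upwards [h4, hθ] with x hx hx'
    rwa [← hx']
  · rwa [← hres]
  · rw [← hres]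
    filter_upwards [h6, hθ] with x hx hx'
    intro f hf hfs
    rw [← hx']
    refine (hx f hf hfs).congr fun r => ?_
    rw [← hres]
    congr 1
    refine integral_congr_ae ?_
    filter_upwards [hθ] with y hy
    rw [hy]
  · rw [h7, ← hres]
    congr 1
    refine withDensity_congr_ae ?_
    filter_upwards [hθ] with y hy
    rw [hy]

theorem integrable_sq_of_willmore {V : Measure GBundle} {H : GBundle → E3}
    (hH : LocallyIntegrable H V) (hW : willmore V H < ⊤) :
    Integrable (fun z => ‖H z‖ ^ 2) V ∧ ∫ z, ‖H z‖ ^ 2 ∂V = (willmore V H).toReal := by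
  have hm : AEStronglyMeasurable (fun z => ‖H z‖ ^ 2) V := hH.aestronglyMeasurable.norm.pow 2
  have he : ∀ z, ENNReal.ofReal (‖H z‖ ^ 2) = ‖H z‖ₑ ^ 2 := fun z => by
    rw [ENNReal.ofReal_pow (norm_nonneg _), ofReal_norm]
  constructor
  · refine ⟨hm, ?_⟩
    rw [hasFiniteIntegral_iff_ofReal (Eventually.of_forall fun _ => sq_nonneg _)]
    simp only [he]
    exact hW
  · rw [integral_eq_lintegral_of_nonneg_ae (Eventually.of_forall fun _ => sq_nonneg _) hm]
    simp only [he, willmore]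

theorem weight_ball (V : Measure GBundle) (p : E3) (ρ : ℝ) :
    weight V (Metric.ball p ρ) = V (cyl p ρ) := by
  rw [weight, Measure.map_apply measurable_fst measurableSet_ball]
  rfl

/-- The distance of the boundary to a point off the closed set carrying it. -/
theorem exists_dist_boundary {σ : Measure E3} {S : Set E3} (hS : IsClosed S) (hσ : σ Sᶜ = 0)
    {p : E3} (hp : p ∉ S) : ∃ d : ℝ, 0 < d ∧ (∀ᵐ x ∂σ, d ≤ ‖x - p‖) ∧
      d⁻¹ * σ.real univ = (Metric.infEDist p S).toReal⁻¹ * (σ S).toReal := by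
  have hae : ∀ᵐ x ∂σ, x ∈ S := by
    rw [ae_iff]; exact hσ
  have huniv : σ univ = σ S := by
    refine measure_congr ?_
    filter_upwards [hae] with x hx
    exact propext ⟨fun _ => hx, fun _ => trivial⟩
  rcases S.eq_empty_or_nonempty with rfl | hne
  -- For empty S the distance is infinite, its real value and the inverse are 0, and σ vanishes, so
  -- both sides are 0 and d = 1 is arbitrary.
  · refine ⟨1, one_pos, hae.mono fun x hx => absurd hx (notMem_empty x), ?_⟩
    simp [measureReal_def, huniv]
  · refine ⟨Metric.infDist p S, (hS.notMem_iff_infDist_pos hne).mp hp, hae.mono fun x hx => ?_, ?_⟩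
    · rw [← dist_eq_norm, dist_comm]
      exact Metric.infDist_le_dist_of_mem hx
    · rw [measureReal_def, huniv]
      rfl

/-- Adding 1 makes the limsup bound strict, so it holds for all large radii. -/
theorem eventually_massRatio_le {V : Measure GBundle} {K : ℝ≥0}
    (hK : limsup (fun R : ℝ => weight V (Metric.ball 0 R) / ENNReal.ofReal (R ^ 2)) atTop ≤
      (K : ℝ≥0∞)) : ∀ᶠ R in atTop, massRatio V 0 R ≤ K + 1 := by
  have hlt : limsup (fun R : ℝ => weight V (Metric.ball 0 R) / ENNReal.ofReal (R ^ 2)) atTop <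
      ((K + 1 : ℝ≥0) : ℝ≥0∞) := hK.trans_lt (by exact_mod_cast lt_add_one K)
  filter_upwards [eventually_lt_of_limsup_lt hlt] with R hR
  have := ENNReal.toReal_mono ENNReal.coe_ne_top hR.le
  rw [ENNReal.toReal_div, ENNReal.toReal_ofReal (sq_nonneg R), weight_ball] at this
  exact_mod_cast this

/-- Points outside the carrier at which the density is at least `1/2` are negligible. -/
theorem IsIntegerRectifiable.measure_diff_carrier_eq_zero {V : Measure GBundle} {M : Set E3}
    {θ L : E3 → ℝ} (h : IsIntegerRectifiable V M θ) {E : Set E3} (hEM : Disjoint E M)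
    (hL : ∀ p ∈ E, Tendsto (massRatio V p) (𝓝[>] 0) (𝓝 (L p))) (h1 : ∀ p ∈ E, 1 < L p) :
    (μHE[2] : Measure E3) E = 0 := by
  have hVloc := h.1
  have hwloc := locallyFinite_weight V
  refine hausdorffMeasure_eq_zero_of_mass_ge (μ := weight V) ?_ fun p hp => ?_
  · rw [h.weight_eq]
    refine withDensity_absolutelyContinuous _ _ ?_
    refine measure_mono_null (fun x hx => ?_) (ae_restrict_mem₀ h.2.1.1)
    exact hEM.notMem_of_mem_left hx
  · filter_upwards [(hL p hp).eventually_const_lt (h1 p hp), self_mem_nhdsWithin] with r hr hr0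
    have hr0 : 0 < r := hr0
    rw [massRatio, lt_div_iff₀ (by positivity), one_mul] at hr
    rw [weight_ball]
    exact (ENNReal.ofReal_le_ofReal hr.le).trans ENNReal.ofReal_toReal_le

/-- At a point off S below the threshold, semicontinuity keeps the values below it nearby, and S
being closed keeps nearby points off S. -/
theorem isClosed_superlevel_union {θ : E3 → ℝ} {S : Set E3} (hS : IsClosed S)
    (hθ : UpperSemicontinuousOn θ Sᶜ) (c : ℝ) : IsClosed ({p | p ∉ S ∧ c ≤ θ p} ∪ S) := by
  rw [← isOpen_compl_iff, isOpen_iff_eventually]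
  intro p hp
  simp only [mem_compl_iff, mem_union, mem_ofPred_eq, not_or, not_and, not_le] at hp ⊢
  have hev := hθ p hp.2 c (hp.1 hp.2)
  rw [hS.isOpen_compl.nhdsWithin_eq hp.2] at hev
  filter_upwards [hev, hS.isOpen_compl.mem_nhds hp.2] with q hq hqS
  exact ⟨fun _ => hq, hqS⟩

end CurvVarifold

/-! ### The proposition -/

theorem mainTheorem10 :
    ∃ C : ℝ≥0∞ → ℝ≥0∞ → ℝ≥0 → ℝ≥0∞ → ℝ,
    ∀ (V : Measure CurvVarifold.GBundle) (M₀ : Set CurvVarifold.E3) (θ₀ : CurvVarifold.E3 → ℝ)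
      (A : Fin 3 → Fin 3 → Fin 3 → CurvVarifold.GBundle → ℝ)
      (bd : CurvVarifold.RadonVectorMeasure CurvVarifold.GBundle)
      (σ : CurvVarifold.RadonVectorMeasure CurvVarifold.E3)
      (S : Set CurvVarifold.E3) (K : ℝ≥0),
      CurvVarifold.IsIntegerRectifiable V M₀ θ₀ →
      CurvVarifold.IsCurvatureVarifold V A bd →
      CurvVarifold.IsGeneralizedBoundary V (CurvVarifold.meanCurvature A) σ →
      CurvVarifold.IsCompactOneManifold S →
      (μHE[1] : Measure CurvVarifold.E3) S < ⊤ →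
      σ.tv.support ⊆ S →
      CurvVarifold.willmore V (CurvVarifold.meanCurvature A) < ⊤ →
      limsup (fun R : ℝ =>
        CurvVarifold.weight V (Metric.ball 0 R) / ENNReal.ofReal (R ^ 2)) atTop ≤ (K : ℝ≥0∞) →
      ∃ θ : CurvVarifold.E3 → ℝ,
        (∀ p ∉ S, Tendsto
          (fun ρ : ℝ => (CurvVarifold.weight V (Metric.ball p ρ)).toReal / (Real.pi * ρ ^ 2))
          (𝓝[>] 0) (𝓝 (θ p))) ∧
        UpperSemicontinuousOn θ Sᶜ ∧
        (∀ p ∉ S, θ p ≤ C (Metric.infEDist p S) (σ.tv S) K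
          (CurvVarifold.willmore V (CurvVarifold.meanCurvature A))) ∧
        IsClosed ({p | p ∉ S ∧ 1 / 2 ≤ θ p} ∪ S) ∧
        CurvVarifold.IsIntegerRectifiable V ({p | p ∉ S ∧ 1 / 2 ≤ θ p} ∪ S) θ := by
  open CurvVarifold in
  -- The bound of `density_le` with k = K + 1, divided by π to pass from the limit of μ(B_ρ)/ρ² to
  -- the normalised density.
  refine ⟨fun d s K W => (8 * (K + 1) + 1 / 2 * W.toReal + d.toReal⁻¹ * s.toReal) / Real.pi, ?_⟩
  intro V M₀ θ₀ A bd σ S K hV hA hb hS hS1 hsupp hwill hK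
  have hVloc := hV.1
  have hσloc := σ.locallyFinite
  obtain ⟨T, hT, hgraph⟩ := hV.exists_graph
  have hperp := hA.ae_perp hT hgraph
  obtain ⟨hW, hWeq⟩ := integrable_sq_of_willmore hb.1 hwill
  have hScl : IsClosed S := hS.1.isClosed
  have hσS : σ.tv Sᶜ = 0 :=
    measure_mono_null (compl_subset_compl.mpr hsupp) Measure.measure_compl_support
  have hσfin : IsFiniteMeasure σ.tv := ⟨by
    rw [← union_compl_self S]
    refine (measure_union_le _ _).trans_lt ?_
    rw [hσS, add_zero]
    exact hS.1.measure_lt_top⟩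
  have hpi := Real.pi_pos
  -- Values on S are left unconstrained; S is ℋ²-null, so they do not affect V.
  have hex : ∀ p, ∃ L : ℝ, p ∉ S → Tendsto (massRatio V p) (𝓝[>] 0) (𝓝 L) ∧
      Tendsto (energy V (meanCurvature A) p) (𝓝[>] 0) (𝓝 0) := by
    intro p
    by_cases hp : p ∈ S
    · exact ⟨0, fun h => absurd hp h⟩
    · obtain ⟨d, hd, hdσ, -⟩ := exists_dist_boundary hScl hσS hp
      obtain ⟨L, h1, h2, -⟩ := hb.exists_density hperp hW hd hdσ
      exact ⟨L, fun _ => ⟨h1, h2⟩⟩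
  choose L hL using hex
  have hLle : ∀ p ∉ S, ∀ d, 0 < d → (∀ᵐ x ∂σ.tv, d ≤ ‖x - p‖) → ∀ ρ ∈ Ioo 0 d,
      L p ≤ monoQuantity V (meanCurvature A) p ρ := by
    intro p hp d hd hdσ
    obtain ⟨L', h1, -, h3⟩ := hb.exists_density hperp hW hd hdσ
    rwa [tendsto_nhds_unique (hL p hp).1 h1]
  have husc : UpperSemicontinuousOn (fun p => L p / Real.pi) Sᶜ := by
    intro p hp y hy
    rw [div_lt_iff₀ hpi] at hy
    obtain ⟨d, hd, hdσ, -⟩ := exists_dist_boundary hScl hσS hp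
    -- Radius below d/2 and centre within d/2 of p: the boundary then stays at distance at least d/2
    -- > ρ from q, and A(ρ) at q bounds the density there.
    obtain ⟨ρ, hρ, hev⟩ := hb.eventually_density_lt hW (half_pos hd) (hL p hp).1 (hL p hp).2 hy
    filter_upwards [nhdsWithin_le_nhds hev, nhdsWithin_le_nhds (Metric.ball_mem_nhds p (half_pos hd)),
      self_mem_nhdsWithin] with q hq hqp hqS
    rw [div_lt_iff₀ hpi]
    refine (hLle q hqS (d / 2) (half_pos hd) (hdσ.mono fun x hx => ?_) ρ hρ).trans_lt hq
    have h1 : ‖x - p‖ ≤ ‖x - q‖ + ‖q - p‖ := by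
      simpa only [dist_eq_norm] using dist_triangle x q p
    have h2 : ‖q - p‖ < d / 2 := mem_ball_iff_norm.mp hqp
    linarith
  refine ⟨fun p => L p / Real.pi, fun p hp => ?_, husc, fun p hp => ?_,
    isClosed_superlevel_union hScl husc _, ?_⟩
  · refine ((hL p hp).1.div_const Real.pi).congr fun ρ => ?_
    rw [massRatio, weight_ball, measureReal_def, div_div, mul_comm]
  · obtain ⟨d, hd, hdσ, hdeq⟩ := exists_dist_boundary hScl hσS hp
    have := hb.density_le hperp hW hd hdσ (hLle p hp d hd hdσ) (eventually_massRatio_le hK)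
    rw [hWeq, hdeq] at this
    exact div_le_div_of_nonneg_right this hpi.le
  · have hS2 : (μHE[2] : Measure E3) S = 0 :=
      (Measure.euclideanHausdorffMeasure_zero_or_top one_lt_two S).resolve_right hS1.ne
    have hSae : ∀ᵐ x ∂(μHE[2] : Measure E3).restrict M₀, x ∉ S :=
      ae_restrict_of_ae (measure_eq_zero_iff_ae_notMem.mp hS2)
    have hgood : ∀ᵐ x ∂(μHE[2] : Measure E3).restrict M₀,
        x ∉ S ∧ 1 ≤ θ₀ x ∧ θ₀ x = L x / Real.pi := by
      obtain ⟨-, -, -, h4, T', -, h6, -⟩ := id hV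
      filter_upwards [hSae, h4, h6] with x hx hx4 hx6
      obtain ⟨m, hm1, hm⟩ := hx4
      have h1 : 1 ≤ θ₀ x := by rw [hm]; exact_mod_cast hm1
      refine ⟨hx, h1, ?_⟩
      rw [density_eq_of_isApproxTangentPlane hV hx6 (by linarith) (hL x hx).1]
      field_simp
    -- Almost every point of the old carrier has density equal to a multiplicity at least 1, so it
    -- lies in the new set; the reverse difference is handled by the covering lemma.
    refine hV.congr (ae_eq_set.mpr ⟨?_, ?_⟩) (hgood.mono fun x hx => hx.2.2)
    · rw [ae_restrict_iff'₀ hV.2.1.1] at hgood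
      refine measure_mono_null ?_ (ae_iff.mp hgood)
      rintro x hx h'
      refine hx.2 ?_
      obtain ⟨h1, h2, h3⟩ := h' hx.1
      exact Or.inl ⟨h1, by dsimp only; rw [← h3]; linarith⟩
    · refine measure_mono_null (t := {p | p ∉ S ∧ 1 / 2 ≤ L p / Real.pi} \ M₀ ∪ S) ?_
        (measure_union_null ?_ hS2)
      · rintro x ⟨hx | hx, hx'⟩
        · exact Or.inl ⟨hx, hx'⟩
        · exact Or.inr hx
      · refine hV.measure_diff_carrier_eq_zero (L := L) disjoint_sdiff_left
          (fun p hp => (hL p hp.1.1).1) fun p hp => ?_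
        -- Normalised density at least 1/2 means a limit of mass ratios at least π/2 > 1, the
        -- threshold of the covering lemma.
        have := hp.1.2
        rw [le_div_iff₀ hpi] at this
        linarith [Real.pi_gt_three]
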